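/- Let $L$ be a countable language. Let $\mathcal C$ be a Fraïssé class of finitely generated $L$-structures (a nonempty class with countably many isomorphism types, hereditary, with the joint embedding and amalgamation properties), with Fraïssé limit $M$, and assume that $M$ is not finitely generated. A *system* is a pair $X=\langle A,\psi:B\to C\rangle$, where $A$ is an $L$-structure and $\psi$ is an isomorphism between substructures $B,C$ of $A$. An *embedding* of $\langle A,\psi:B\to C\rangle$ into $\langle D,\varphi:E\to F\rangle$ is an embedding $f:A\to D$ of $L$-structures with $f(B)\subseteq E$, $f(C)\subseteq F$ and $f\circ\psi\subseteq\varphi\circ f$; isomorphisms are embeddings that have an inverse embedding. Let $\mathcal C_p$ be the class of systems with $A,B,C\in\mathcal C$. $\mathcal C_p$ has (JEP) if any two members embed into a common member. It has (WAP) if for each $A\in\mathcal C_p$ there are $B\in\mathcal C_p$ and an embedding $e:A\to B$ such that for all embeddings $h_i:B\to B_i$ with $B_i\in\mathcal C_p$ ($i=1,2$) there are $D\in\mathcal C_p$ and embeddings $g_i:B_i\to D$ with $g_1h_1e=g_2h_2e$. Let $X$ be a system. Say that an embedding $e:A\to B$ in $\mathcal C_p$ is *good for* $X$ if for any two embeddings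 $h_1,h_2:B\to X$ there is an automorphism $\sigma$ of $X$ with $\sigma h_1e=h_2e$. A countable system $X$ is a *weak Fraïssé limit* of $\mathcal C_p$ if it is *universal* (the systems $\langle A,\psi:B\to C\rangle$ with $A,B$ finitely generated that embed into $X$ are exactly the members of $\mathcal C_p$) and *weakly homogeneous* (each $A\in\mathcal C_p$ has an embedding $e:A\to B$, $B\in\mathcal C_p$, that is good for $X$). Call $X$ *weakly homogeneous everywhere* if for every embedding $i:A\to X$ with $A\in\mathcal C_p$ there are $B\in\mathcal C_p$, an embedding $e:A\to B$ good for $X$, and an embedding $j:B\to X$ with $je=i$. Let $\mathbb S_p$ be the set of pairs $(N,h)$, where $N$ is a structure with universe $\omega$ that is not finitely generated and all of whose finitely generated substructures are in $\mathcal C$ (up to isomorphism), and $h\in\mathrm{Aut}(N)$. Its topology is generated by the following sets, one for each system $\langle A,\psi\rangle\in\mathcal C_p$ whose universe is a subset of $\omega$: the set of all $(N,h)$ such that $A$ is a substructure of $N$ and $h$ extends $\psi$. Pairs $(N,h)$ with $h\in\mathrm{Aut}(N)$ are regarded as systems. A system $X$ has *comeager isomorphism type* if $\{Y\in\mathbb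 S_p: Y\cong X\}$ is comeager in $\mathbb S_p$. Give $\mathrm{Aut}(M)$ the topology of pointwise convergence, and call $f\in\mathrm{Aut}(M)$ *generic* if its conjugacy class is comeager in $\mathrm{Aut}(M)$. **Theorem.** The following are equivalent: 1. $\mathcal C_p$ has (JEP) and (WAP). 2. There is a weak Fraïssé limit of $\mathcal C_p$ in $\mathbb S_p$ that has comeager isomorphism type in $\mathbb S_p$. 3. There is a generic $f\in\mathrm{Aut}(M)$. If these conditions hold, then the weak Fraïssé limit has the form $(M,f)$ with $f$ generic, in the following sense. For every generic $f\in\mathrm{Aut}(M)$, the system $(M,f)$ is a weak Fraïssé limit of $\mathcal C_p$, is weakly homogeneous everywhere, and has comeager isomorphism type in $\mathbb S_p$. Conversely, every weak Fraïssé limit $X$ of $\mathcal C_p$ that has comeager isomorphism type in $\mathbb S_p$ or is weakly homogeneous everywhere is isomorphic to $(M,f)$ for some generic $f\in\mathrm{Aut}(M)$. -/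

import Mathlib

open FirstOrder.Language CategoryTheory
open scoped FirstOrder

universe u v w

/-- A system `⟨A, ψ : B → C⟩`: an `L`-structure `A` together with an isomorphism `ψ` between two
substructures `B`, `C` of `A`. No finiteness is imposed here. -/
structure PSystem (L : FirstOrder.Language.{u, v}) where
  carrier : Type w
  [str : L.Structure carrier]
  map : L.PartialEquiv carrier carrier

attribute [instance] PSystem.str

namespace PSystem

variable {L : FirstOrder.Language.{u, v}}

/-- An embedding of `⟨A, ψ : B → C⟩` into `⟨D, φ : E → F⟩`: an embedding `f : A → D` which maps `B`
into `E` and `C` into `F`, and such that `f ∘ ψ ⊆ φ ∘ f`. -/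
structure Emb (S T : PSystem.{u, v, w} L) where
  toEmb : S.carrier ↪[L] T.carrier
  map_dom : ∀ x ∈ S.map.dom, toEmb x ∈ T.map.dom
  map_cod : ∀ x ∈ S.map.cod, toEmb x ∈ T.map.cod
  comm : ∀ x : S.map.dom,
    toEmb (S.map.toEquiv x : S.carrier) =
      (T.map.toEquiv ⟨toEmb (x : S.carrier), map_dom x x.2⟩ : T.carrier)

/-- An isomorphism of systems: an embedding with an inverse that is also an embedding. -/
structure Iso (S T : PSystem.{u, v, w} L) where
  hom : Emb S T
  inv : Emb T S
  left_inv : ∀ x, inv.toEmb (hom.toEmb x) = x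
  right_inv : ∀ y, hom.toEmb (inv.toEmb y) = y

/-- The system `(M, f)` given by a structure `M` and an automorphism `f` of `M`. -/
def ofAut {M : Type w} [L.Structure M] (f : M ≃[L] M) : PSystem.{u, v, w} L where
  carrier := M
  map :=
    { dom := ⊤
      cod := ⊤
      toEquiv := Substructure.topEquiv.symm.comp (f.comp Substructure.topEquiv) }

/-- The class of systems `⟨A, ψ : B → C⟩` with `A`, `B`, `C` in `C`. -/
def classOf (C : Set (Bundled.{w} L.Structure)) : Set (PSystem.{u, v, w} L) :=
  {S | Bundled.of (c := L.Structure) S.carrier ∈ C ∧ Bundled.of (c := L.Structure) S.map.dom ∈ C ∧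
    Bundled.of (c := L.Structure) S.map.cod ∈ C}

/-- The joint embedding property of a class of systems. -/
def JEP (K : Set (PSystem.{u, v, w} L)) : Prop :=
  ∀ A ∈ K, ∀ B ∈ K, ∃ D ∈ K, Nonempty (Emb A D) ∧ Nonempty (Emb B D)

/-- The weak amalgamation property of a class of systems. -/
def WAP (K : Set (PSystem.{u, v, w} L)) : Prop :=
  ∀ A ∈ K, ∃ B ∈ K, ∃ e : Emb A B,
    ∀ B₁ ∈ K, ∀ B₂ ∈ K, ∀ (h₁ : Emb B B₁) (h₂ : Emb B B₂),
      ∃ D ∈ K, ∃ (g₁ : Emb B₁ D) (g₂ : Emb B₂ D),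
        ∀ a, g₁.toEmb (h₁.toEmb (e.toEmb a)) = g₂.toEmb (h₂.toEmb (e.toEmb a))

/-- The age of a system `X`: the finitely generated systems that embed into `X`. -/
def age (X : PSystem.{u, v, w} L) : Set (PSystem.{u, v, w} L) :=
  {S | Structure.FG L S.carrier ∧ S.map.dom.FG ∧ Nonempty (Emb S X)}

/-- Any two copies of `B` in `X` are moved to each other by an automorphism of `X`, as far as their
restrictions along `e : A → B` are concerned: every isomorphism `h₂ ∘ h₁⁻¹` between subsystems of
`X` isomorphic to `B` extends, on the part coming from `A`, to an automorphism of `X`. -/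
def HomogeneousAlong (X : PSystem.{u, v, w} L) {A B : PSystem.{u, v, w} L} (e : Emb A B) : Prop :=
  ∀ h₁ h₂ : Emb B X, ∃ σ : Iso X X,
    ∀ a, σ.hom.toEmb (h₁.toEmb (e.toEmb a)) = h₂.toEmb (e.toEmb a)

/-- Weak homogeneity of `X` with respect to a class `K`. -/
def WeaklyHomogeneous (K : Set (PSystem.{u, v, w} L)) (X : PSystem.{u, v, w} L) : Prop :=
  ∀ A ∈ K, ∃ B ∈ K, ∃ e : Emb A B, HomogeneousAlong X e

/-- Weak homogeneity around every copy: every copy `i` in `X` of a system `A` in `K` lies in a copy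
`j` in `X` of some `B` in `K` that witnesses weak homogeneity for `A`. -/
def WeaklyHomogeneousEverywhere (K : Set (PSystem.{u, v, w} L)) (X : PSystem.{u, v, w} L) : Prop :=
  ∀ A ∈ K, ∀ i : Emb A X, ∃ B ∈ K, ∃ (e : Emb A B) (j : Emb B X),
    (∀ a, j.toEmb (e.toEmb a) = i.toEmb a) ∧ HomogeneousAlong X e

/-- `X` is a weak Fraïssé limit of `K`: countable, universal and weakly homogeneous. -/
structure IsWeakFraisseLimit (K : Set (PSystem.{u, v, w} L)) (X : PSystem.{u, v, w} L) : Prop where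
  countable : Countable X.carrier
  universal : X.age = K
  weaklyHomogeneous : WeaklyHomogeneous K X

end PSystem

/-- The space of pairs `(N, h)` where `N` is a structure with universe `ℕ` which is not finitely
generated and has age contained in `C`, and `h` is an automorphism of `N`. -/
structure AutSpace {L : FirstOrder.Language.{u, v}} (C : Set (Bundled.{0} L.Structure)) where
  str : L.Structure ℕ
  age_subset : L.age ℕ ⊆ C
  not_fg : ¬ Structure.FG L ℕ
  aut : ℕ ≃[L] ℕ

namespace AutSpace

variable {L : FirstOrder.Language.{u, v}} {C : Set (Bundled.{0} L.Structure)}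

/-- A point `(N, h)` of the space, as a system. -/
def toPSystem (X : AutSpace C) : PSystem.{u, v, 0} L :=
  letI := X.str
  PSystem.ofAut X.aut

/-- For a system `⟨A, ψ⟩` whose universe is a subset `A` of `ℕ`, the set of all `(N, h)` such that
the structure induced by `N` on `A` is the given one and `h` extends `ψ`: in other words, the
inclusion of `A` into `ℕ` is an embedding of systems. -/
def basicOpen (C : Set (Bundled.{0} L.Structure)) (A : Set ℕ) [L.Structure A]
    (ψ : L.PartialEquiv A A) : Set (AutSpace C) :=
  {Y | ∃ e : PSystem.Emb (PSystem.mk (L := L) A ψ) Y.toPSystem, ∀ a : A, e.toEmb a = (a : ℕ)}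

/-- The topology generated by the sets `basicOpen C A ψ`, for `⟨A, ψ⟩` in the class of systems
over `C` with universe contained in `ℕ`. -/
instance : TopologicalSpace (AutSpace C) :=
  TopologicalSpace.generateFrom
    {U | ∃ (A : Set ℕ) (_ : L.Structure A) (ψ : L.PartialEquiv A A),
      PSystem.mk (L := L) A ψ ∈ PSystem.classOf C ∧ U = basicOpen C A ψ}

/-- The isomorphism type of a system `X` in the space: all points isomorphic to `X`. -/
def isoType (C : Set (Bundled.{0} L.Structure)) (X : PSystem.{u, v, 0} L) : Set (AutSpace C) :=
  {Y | Nonempty (PSystem.Iso X Y.toPSystem)}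

end AutSpace

/-- The topology of pointwise convergence on the automorphism group of a (discrete) structure. -/
@[reducible]
def autTopology (L : FirstOrder.Language.{u, v}) (M : Type w) [L.Structure M] :
    TopologicalSpace (M ≃[L] M) :=
  TopologicalSpace.induced (fun f : M ≃[L] M => (f : M → M))
    (@Pi.topologicalSpace M (fun _ => M) (fun _ => ⊥))

/-- The conjugacy class of `f` in the automorphism group. -/
def autConjClass {L : FirstOrder.Language.{u, v}} {M : Type w} [L.Structure M] (f : M ≃[L] M) :
    Set (M ≃[L] M) :=
  {h | ∃ g : M ≃[L] M, h = g.comp (f.comp g.symm)}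

/-- `f` has a comeager conjugacy class in the automorphism group. -/
def IsGenericAut {L : FirstOrder.Language.{u, v}} {M : Type w} [L.Structure M] (f : M ≃[L] M) : Prop :=
  autConjClass f ∈ @residual (M ≃[L] M) (autTopology L M)

/-! Let K be the class of systems over the age of M. The pivot is the notion `IsRich`: X has age K,
every finite part of X lies in a copy of some B in K whose extensions amalgamate over that part, and
an extension of such a B is realized in X with the finite part kept in place. Back and forth through
such copies shows that two countable rich pairs (N, h) are isomorphic (`Linked.exists_equiv`). Run
inside one pair, it gives weak homogeneity around every copy.

If K has (JEP) and (WAP), the rich points are comeager both in Aut(M) and in the space of pairs,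
since richness follows from countably many comeager conditions. `IndexedAutSpace` records what this
argument needs of either space. Comeager sets are nonempty by a Baire argument with converging pairs
(enumeration of M, automorphism of M). So a rich f exists, all rich automorphisms of M are conjugate
to it, and all rich points of the space are isomorphic to it: f is generic and has comeager
isomorphism type. Every generic f is rich, because two comeager sets meet.

Conversely, copies of two systems in one pair (N, h) lie in a common finitely generated subsystem.
This gives (JEP) from universality, and (WAP) once weak homogeneity makes the copies agree on A. For
generic f the second point comes from category: the conjugates of f by v fall into countably many
pieces according to the values of v on generators of A, so one piece is somewhere dense. Extensions
realized there are pulled back to (M, f) without moving A (`IsGenericAut.wap`).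

A weak limit of comeager type is isomorphic to a rich point, and one that is weakly homogeneous
everywhere is itself rich (`WeaklyHomogeneousEverywhere.isRich`), with a total partial map. -/

namespace PSystem

variable {L : FirstOrder.Language.{u, v}}

/-! ### Embeddings and finitely generated subsystems of a pair (N, h) -/

namespace Emb

variable {S T U : PSystem.{u, v, w} L}

instance : CoeFun (Emb S T) (fun _ => S.carrier → T.carrier) := ⟨fun f => f.toEmb⟩

theorem injective (f : Emb S T) : Function.Injective f := f.toEmb.injective

/-- The identity embedding of a system. -/
protected def refl (S : PSystem.{u, v, w} L) : Emb S S where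
  toEmb := Embedding.refl L _
  map_dom _ hx := hx
  map_cod _ hx := hx
  comm _ := rfl

/-- The composition of embeddings of systems. -/
def comp (g : Emb T U) (f : Emb S T) : Emb S U where
  toEmb := g.toEmb.comp f.toEmb
  map_dom x hx := g.map_dom _ (f.map_dom x hx)
  map_cod x hx := g.map_cod _ (f.map_cod x hx)
  comm x := by
    have h := g.comm ⟨f x, f.map_dom x x.2⟩
    rw [← f.comm x] at h
    exact h

theorem comp_apply (g : Emb T U) (f : Emb S T) (a : S.carrier) : (g.comp f) a = g (f a) := rfl

/-- An embedding of the underlying structure of `S` into `N` which commutes with the action of the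
automorphism `h`, as an embedding of systems. -/
def toAut {N : Type w} [L.Structure N] (h : N ≃[L] N) (f : S.carrier ↪[L] N)
    (hf : ∀ x : S.map.dom, f (S.map.toEquiv x : S.carrier) = h (f (x : S.carrier))) :
    Emb S (ofAut h) where
  toEmb := f
  map_dom _ _ := Substructure.mem_top _
  map_cod _ _ := Substructure.mem_top _
  comm x := hf x

theorem comm_aut {N : Type w} [L.Structure N] {h : N ≃[L] N} (f : Emb S (ofAut h))
    (x : S.map.dom) : f.toEmb (S.map.toEquiv x : S.carrier) = h (f.toEmb (x : S.carrier)) :=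
  f.comm x

theorem apply_mem_cod {N : Type w} [L.Structure N] {h : N ≃[L] N} (f : Emb S (ofAut h))
    {x : S.carrier} (hx : x ∈ S.map.dom) : ∃ y, y ∈ S.map.cod ∧ f.toEmb y = h (f.toEmb x) :=
  ⟨_, (S.map.toEquiv ⟨x, hx⟩).2, f.comm_aut ⟨x, hx⟩⟩

end Emb

/-- Two embeddings that agree on a generating set are equal. -/
theorem embedding_eq_of_eqOn {A N : Type*} [L.Structure A] [L.Structure N] {G : Set A}
    (hG : Substructure.closure L G = ⊤) {i j : A ↪[L] N} (h : ∀ a ∈ G, i a = j a) (a : A) :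
    i a = j a :=
  Hom.eqOn_closure (f := i.toHom) (g := j.toHom) h (by rw [hG]; trivial)

variable {N : Type w} [L.Structure N]

/-- An embedding into `(N, h)` factors through every subsystem the domain of whose partial map
contains the image of a generating set. -/
theorem exists_factor {A D : PSystem.{u, v, w} L} {h : N ≃[L] N} (i : Emb A (ofAut h))
    (d : Emb D (ofAut h)) {G : Set A.carrier} (hG : Substructure.closure L G = ⊤)
    (hi : ∀ a ∈ G, ∃ c ∈ D.map.dom, d c = i a) : ∃ e : Emb A D, ∀ a, d (e a) = i a := by
  let iN : A.carrier ↪[L] N := i.toEmb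
  let dN : D.carrier ↪[L] N := d.toEmb
  have key : ∀ a, ∃ c ∈ D.map.dom, dN c = iN a := by
    intro a
    -- The points sent by i into the image of the domain of D form a substructure, so generators
    -- suffice. Having all of A land in that domain makes compatibility with the partial maps
    -- automatic.
    have hle : Substructure.closure L G ≤ (D.map.dom.map dN.toHom).comap iN.toHom :=
      Substructure.closure_le.2 fun a ha => hi a ha
    exact hle (by rw [hG]; trivial : a ∈ Substructure.closure L G)
  let e : A.carrier ↪[L] D.carrier := dN.equivRange.symm.toEmbedding.comp
    (iN.codRestrict dN.toHom.range fun a => by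
      obtain ⟨c, -, hc⟩ := key a
      exact ⟨c, hc⟩)
  have he : ∀ a, dN (e a) = iN a := fun a => by
    have := dN.equivRange_apply (e a)
    rw [← this]
    simp [e]
  have hdom : ∀ a, e a ∈ D.map.dom := fun a => by
    obtain ⟨c, hc, hca⟩ := key a
    rwa [← dN.injective (hca.trans (he a).symm)]
  have hcomm : ∀ x : A.map.dom, e (A.map.toEquiv x : A.carrier) =
      (D.map.toEquiv ⟨e (x : A.carrier), hdom x⟩ : D.carrier) := fun x => by
    apply dN.injective
    refine (he _).trans ((i.comm_aut x).trans ?_)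
    refine Eq.trans ?_ (d.comm_aut ⟨e (x : A.carrier), hdom x⟩).symm
    exact congrArg h (he x).symm
  refine ⟨⟨e, fun x _ => hdom x, fun x hx => ?_, hcomm⟩, he⟩
  obtain ⟨y, hy⟩ := A.map.toEquiv.surjective ⟨x, hx⟩
  have := hcomm y
  rw [hy] at this
  rw [this]
  exact (D.map.toEquiv _).2

variable {C : Set (Bundled.{w} L.Structure)}

/-- A finitely generated system on a structure which embeds into `N` belongs to the class. -/
theorem mem_classOf_of_embedding (hN : L.age N ⊆ C) {S : PSystem.{u, v, w} L}
    (hS : Structure.FG L S.carrier) (hd : S.map.dom.FG) (f : S.carrier ↪[L] N) :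
    S ∈ classOf C := by
  have hd' : Structure.FG L S.map.dom := (Substructure.fg_iff_structure_fg _).1 hd
  exact ⟨hN ⟨hS, ⟨f⟩⟩, hN ⟨hd', ⟨f.comp (Substructure.subtype _)⟩⟩,
    hN ⟨S.map.toEquiv.fg_iff.1 hd', ⟨f.comp (Substructure.subtype _)⟩⟩⟩

/-- Every finite subset of `N` is contained in the domain of a finitely generated subsystem of
`(N, h)`. -/
theorem exists_subsystem_of_finite (hN : L.age N ⊆ C) (h : N ≃[L] N) {s : Set N}
    (hs : s.Finite) :
    ∃ D ∈ classOf C, ∃ d : Emb D (ofAut h), ∀ x ∈ s, ∃ c ∈ D.map.dom, d c = x := by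
  let T : L.Substructure N := Substructure.closure L s
  have hT : T.FG := Substructure.fg_closure hs
  -- The partial map is h restricted to T, so the carrier must also contain the image of T.
  let P : L.Substructure N := T ⊔ T.map h.toHom
  have hP : P.FG := hT.sup (hT.map _)
  let dom : L.Substructure P := T.comap P.subtype.toHom
  let f : dom ↪[L] P := ((h.toEmbedding.comp P.subtype).comp dom.subtype).codRestrict P
    fun c => (le_sup_right : T.map h.toHom ≤ P) ⟨_, c.2, rfl⟩
  have hdom : dom.FG := by
    refine Substructure.FG.of_map_embedding P.subtype ?_
    have : dom.map P.subtype.toHom = T := by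
      ext x
      constructor
      · rintro ⟨y, hy, rfl⟩
        exact hy
      · intro hx
        exact ⟨⟨x, (le_sup_left : T ≤ P) hx⟩, hx, rfl⟩
    rwa [this]
  let D : PSystem.{u, v, w} L := ⟨P, ⟨dom, f.toHom.range, f.equivRange⟩⟩
  refine ⟨D, mem_classOf_of_embedding hN ((Substructure.fg_iff_structure_fg _).1 hP) hdom
    P.subtype, Emb.toAut h P.subtype fun _ => rfl, fun x hx => ?_⟩
  have hxT : x ∈ T := Substructure.subset_closure hx
  exact ⟨⟨x, (le_sup_left : T ≤ P) hxT⟩, hxT, rfl⟩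

/-- Any two finitely generated subsystems of `(N, h)` and a finite set are contained in a common
finitely generated subsystem. -/
theorem exists_common_subsystem (hN : L.age N ⊆ C) {h : N ≃[L] N} {A B : PSystem.{u, v, w} L}
    (hA : Structure.FG L A.carrier) (hB : Structure.FG L B.carrier) (i : Emb A (ofAut h))
    (j : Emb B (ofAut h)) {s : Set N} (hs : s.Finite) :
    ∃ D ∈ classOf C, ∃ (d : Emb D (ofAut h)) (e : Emb A D) (k : Emb B D),
      (∀ a, d (e a) = i a) ∧ (∀ b, d (k b) = j b) ∧ ∀ x ∈ s, ∃ c ∈ D.map.dom, d c = x := by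
  obtain ⟨G, hGf, hG⟩ := Structure.fg_iff.1 hA
  obtain ⟨H, hHf, hH⟩ := Structure.fg_iff.1 hB
  obtain ⟨D, hD, d, hd⟩ := exists_subsystem_of_finite hN h
    (hs.union ((hGf.image i).union (hHf.image j)))
  obtain ⟨e, he⟩ := exists_factor i d hG fun a ha => hd _ (Or.inr (Or.inl ⟨a, ha, rfl⟩))
  obtain ⟨k, hk⟩ := exists_factor j d hH fun a ha => hd _ (Or.inr (Or.inr ⟨a, ha, rfl⟩))
  exact ⟨D, hD, d, e, k, he, hk, fun x hx => hd x (Or.inl hx)⟩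

/-! ### Amalgamation over a finite set, and rich systems -/

/-- Any two extensions of `B` in `K` can be amalgamated in `K` over the set `F`. -/
def AmalgamatesOver (K : Set (PSystem.{u, v, w} L)) (B : PSystem.{u, v, w} L)
    (F : Set B.carrier) : Prop :=
  ∀ B₁ ∈ K, ∀ B₂ ∈ K, ∀ (h₁ : Emb B B₁) (h₂ : Emb B B₂),
    ∃ D ∈ K, ∃ (g₁ : Emb B₁ D) (g₂ : Emb B₂ D), ∀ a ∈ F, g₁ (h₁ a) = g₂ (h₂ a)

/-- Extensions of B' become extensions of B by composing with e. This allows an amalgamating copy to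
be enlarged freely while the set stays fixed. -/
theorem AmalgamatesOver.of_emb {K : Set (PSystem.{u, v, w} L)} {B B' : PSystem.{u, v, w} L}
    {F : Set B.carrier} (hB : AmalgamatesOver K B F) (e : Emb B B') {F' : Set B'.carrier}
    (hF : F' ⊆ e '' F) : AmalgamatesOver K B' F' := by
  intro B₁ hB₁ B₂ hB₂ h₁ h₂
  obtain ⟨D, hD, g₁, g₂, hg⟩ := hB B₁ hB₁ B₂ hB₂ (h₁.comp e) (h₂.comp e)
  refine ⟨D, hD, g₁, g₂, fun a ha => ?_⟩
  obtain ⟨b, hb, rfl⟩ := hF ha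
  exact hg b hb

/-- The system `X` has age `K`, the subsystems of `X` over which amalgamation is possible are
cofinal, and `X` realizes every extension of such a subsystem. -/
structure IsRich (K : Set (PSystem.{u, v, w} L)) (X : PSystem.{u, v, w} L) : Prop where
  age_eq : X.age = K
  cofinal : ∀ s : Set X.carrier, s.Finite → ∃ B ∈ K, ∃ j : Emb B X,
    s ⊆ Set.range j ∧ AmalgamatesOver K B (j ⁻¹' s)
  extension : ∀ B ∈ K, ∀ B' ∈ K, ∀ (j : Emb B X) (h : Emb B B') (F : Set B.carrier), F.Finite →
    AmalgamatesOver K B F → ∃ g : Emb B' X, ∀ b ∈ F, g (h b) = j b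

theorem IsRich.nonempty_emb {K : Set (PSystem.{u, v, w} L)} {X A : PSystem.{u, v, w} L}
    (hX : IsRich K X) (hA : A ∈ K) : Nonempty (Emb A X) := by
  rw [← hX.age_eq] at hA
  exact hA.2.2

theorem IsRich.of_iso {K : Set (PSystem.{u, v, w} L)} {X Y : PSystem.{u, v, w} L}
    (hX : IsRich K X) (σ : Iso X Y) : IsRich K Y where
  age_eq := by
    rw [← hX.age_eq]
    ext S
    exact ⟨fun ⟨h₁, h₂, ⟨f⟩⟩ => ⟨h₁, h₂, ⟨σ.inv.comp f⟩⟩,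
      fun ⟨h₁, h₂, ⟨f⟩⟩ => ⟨h₁, h₂, ⟨σ.hom.comp f⟩⟩⟩
  cofinal s hs := by
    obtain ⟨B, hB, j, hsj, hj⟩ := hX.cofinal (σ.inv '' s) (hs.image _)
    refine ⟨B, hB, σ.hom.comp j, fun x hx => ?_, ?_⟩
    · obtain ⟨b, hb⟩ := hsj ⟨x, hx, rfl⟩
      exact ⟨b, by rw [Emb.comp_apply, hb, σ.right_inv]⟩
    · convert hj using 1
      ext b
      constructor
      · intro hb
        exact ⟨_, hb, by rw [Emb.comp_apply, σ.left_inv]⟩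
      · rintro ⟨x, hx, hxb⟩
        rw [Set.mem_preimage, Emb.comp_apply, ← hxb, σ.right_inv]
        exact hx
  extension B hB B' hB' j h F hF hBF := by
    obtain ⟨g, hg⟩ := hX.extension B hB B' hB' (σ.inv.comp j) h F hF hBF
    exact ⟨σ.hom.comp g, fun b hb => by
      rw [Emb.comp_apply, hg b hb, Emb.comp_apply, σ.right_inv]⟩

/-- The age of `(N, h)` consists of systems in the class. -/
theorem age_ofAut_subset (hN : L.age N ⊆ C) (h : N ≃[L] N) : (ofAut h).age ⊆ classOf C :=
  fun _ ⟨h₁, h₂, ⟨f⟩⟩ => mem_classOf_of_embedding hN h₁ h₂ f.toEmb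

theorem mem_age_of_mem_classOf (hC : ∀ A ∈ C, Structure.FG L A) {A X : PSystem.{u, v, w} L}
    (hA : A ∈ classOf C) (f : Emb A X) : A ∈ X.age :=
  ⟨hC _ hA.1, (Substructure.fg_iff_structure_fg _).2 (hC _ hA.2.1), ⟨f⟩⟩

end PSystem

/-! ### Richness is comeager -/

open PSystem Topology

/-- A topological space of pairs `(N, h)` with the points of every `N` indexed by a fixed set `X`,
whose topology is generated by the finitely generated subsystems of the pairs, and in which
every extension of such a subsystem is realized by a nearby pair. -/
structure IndexedAutSpace {L : FirstOrder.Language.{u, v}} (C : Set (Bundled.{0} L.Structure))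
    (Ω : Type*) [TopologicalSpace Ω] (X : Type) where
  carrier : Ω → Type
  [str : ∀ y, L.Structure (carrier y)]
  aut : ∀ y, carrier y ≃[L] carrier y
  index : ∀ y, carrier y ≃ X
  age_subset : ∀ y, L.age (carrier y) ⊆ C
  mem_nhds : ∀ y, ∀ A ∈ classOf C, ∀ i : Emb A (ofAut (aut y)),
    {z | ∃ j : Emb A (ofAut (aut z)), ∀ a, index z (j a) = index y (i a)} ∈ 𝓝 y
  exists_subset : ∀ y, ∀ O ∈ 𝓝 y, ∃ A ∈ classOf C, ∃ i : Emb A (ofAut (aut y)),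
    {z | ∃ j : Emb A (ofAut (aut z)), ∀ a, index z (j a) = index y (i a)} ⊆ O
  exists_extension : ∀ y, ∀ A ∈ classOf C, ∀ D ∈ classOf C, ∀ (i : Emb A (ofAut (aut y)))
    (e : Emb A D), ∃ z, ∃ g : Emb D (ofAut (aut z)), ∀ a, index z (g (e a)) = index y (i a)

attribute [instance] IndexedAutSpace.str

namespace IndexedAutSpace

variable {L : FirstOrder.Language.{u, v}} {C : Set (Bundled.{0} L.Structure)}
  {Ω : Type*} [TopologicalSpace Ω] {X : Type} (𝒮 : IndexedAutSpace C Ω X)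

/-- The point `y` as a system. -/
abbrev sys (y : Ω) : PSystem.{u, v, 0} L := ofAut (𝒮.aut y)

/-- The index of a point of a system. -/
def idx (y : Ω) (x : (𝒮.sys y).carrier) : X := 𝒮.index y x

theorem idx_injective (y : Ω) : Function.Injective (𝒮.idx y) := (𝒮.index y).injective

/-- The points realizing a given finite type. -/
def realizing (D : PSystem.{u, v, 0} L) (p : Set (D.carrier × X)) : Set Ω :=
  {y | ∃ g : Emb D (𝒮.sys y), ∀ c ∈ p, 𝒮.idx y (g c.1) = c.2}

theorem isOpen_realizing {D : PSystem.{u, v, 0} L} (hD : D ∈ classOf C)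
    (p : Set (D.carrier × X)) : IsOpen (𝒮.realizing D p) := by
  refine isOpen_iff_mem_nhds.2 fun y ⟨g, hg⟩ => ?_
  refine Filter.mem_of_superset (𝒮.mem_nhds y D hD g) ?_
  rintro z ⟨j, hj⟩
  exact ⟨j, fun c hc => (hj _).trans (hg c hc)⟩

/-- If every finitely generated subsystem of a point extends to one with an open property `O`, then
`O` is dense. -/
theorem dense_of_forall_subsystem {O : Set Ω}
    (h : ∀ y, ∀ A ∈ classOf C, ∀ _ : Emb A (𝒮.sys y), ∃ D ∈ classOf C, ∃ _ : Emb A D,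
      ∀ z, Nonempty (Emb D (𝒮.sys z)) → z ∈ O) : Dense O := by
  rw [dense_iff_inter_open]
  rintro U hU ⟨y, hy⟩
  obtain ⟨A, hA, i, hi⟩ := 𝒮.exists_subset y U (hU.mem_nhds hy)
  obtain ⟨D, hD, e, hO⟩ := h y A hA i
  obtain ⟨z, g, hg⟩ := 𝒮.exists_extension y A hA D hD i e
  exact ⟨z, hi ⟨g.comp e, hg⟩, hO z ⟨g⟩⟩

/-- A given finite type need not be realized densely. A typical point either realizes it or has a
neighbourhood in which nobody does. -/
theorem isOpen_union_compl_closure_mem_residual {U : Set Ω} (hU : IsOpen U) :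
    U ∪ (_root_.closure U)ᶜ ∈ residual Ω := by
  refine residual_of_dense_open (hU.union isClosed_closure.isOpen_compl) ?_
  rw [dense_iff_closure_eq, closure_union, Set.eq_univ_iff_forall]
  intro x
  by_cases hx : x ∈ _root_.closure U
  · exact Or.inl hx
  · exact Or.inr (subset_closure hx)

/-- The points containing a copy of `B` around `s` over which amalgamation is possible. -/
def amalgamating (C : Set (Bundled.{0} L.Structure)) {Ω : Type*} [TopologicalSpace Ω] {X : Type}
    (𝒮 : IndexedAutSpace C Ω X) (s : Set X) : Set Ω :=
  {y | ∃ B ∈ classOf C, ∃ j : Emb B (𝒮.sys y), s ⊆ Set.range (fun b => 𝒮.idx y (j b)) ∧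
    AmalgamatesOver (classOf C) B ((fun b => 𝒮.idx y (j b)) ⁻¹' s)}

theorem isOpen_amalgamating (s : Set X) : IsOpen (𝒮.amalgamating C s) := by
  refine isOpen_iff_mem_nhds.2 fun y ⟨B, hB, j, hs, hj⟩ => ?_
  refine Filter.mem_of_superset (𝒮.mem_nhds y B hB j) ?_
  rintro z ⟨k, hk⟩
  have : (fun b => 𝒮.idx z (k b)) = fun b => 𝒮.idx y (j b) := funext hk
  exact ⟨B, hB, k, by rwa [this], by rwa [this]⟩

/-- Enlarge the given subsystem to one containing s, apply (WAP) to it, and realize the resulting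
extension at a nearby point. -/
theorem dense_amalgamating (hC : ∀ A ∈ C, Structure.FG L A)
    (hW : WAP (classOf C)) {s : Set X} (hs : s.Finite) : Dense (𝒮.amalgamating C s) := by
  rw [dense_iff_inter_open]
  rintro U hU ⟨y, hy⟩
  obtain ⟨A, hA, i, hi⟩ := 𝒮.exists_subset y U (hU.mem_nhds hy)
  obtain ⟨B, hB, d, e, -, he, -, hd⟩ := exists_common_subsystem (𝒮.age_subset y) (hC _ hA.1)
    (hC _ hA.1) i i (hs.preimage (𝒮.index y).injective.injOn)
  obtain ⟨B', hB', k, hk⟩ := hW B hB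
  obtain ⟨z, g, hg⟩ := 𝒮.exists_extension y B hB B' hB' d k
  have hsub : ∀ x ∈ s, ∃ b, 𝒮.idx z (g (k b)) = x := fun x hx => by
    obtain ⟨c, -, hc⟩ := hd ((𝒮.index y).symm x) (by simpa using hx)
    refine ⟨c, (hg c).trans ?_⟩
    rw [hc]
    exact (𝒮.index y).apply_symm_apply x
  refine ⟨z, hi ⟨(g.comp k).comp e, fun a => (hg _).trans (by rw [he])⟩, B', hB', g, ?_, ?_⟩
  · intro x hx
    obtain ⟨b, hb⟩ := hsub x hx
    exact ⟨_, hb⟩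
  · have hB'' : AmalgamatesOver (classOf C) B' (Set.range k) := by
      intro B₁ hB₁ B₂ hB₂ h₁ h₂
      obtain ⟨D, hD, g₁, g₂, h⟩ := hk B₁ hB₁ B₂ hB₂ h₁ h₂
      exact ⟨D, hD, g₁, g₂, by rintro _ ⟨a, rfl⟩; exact h a⟩
    refine hB''.of_emb (Emb.refl B') fun c hc => ?_
    obtain ⟨b, hb⟩ := hsub _ hc
    exact ⟨c, ⟨b, g.injective (𝒮.idx_injective z hb)⟩, rfl⟩

/-- If the class has joint embeddings and weak amalgamation, then the rich systems form a comeager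
set. -/
theorem isRich_mem_residual [Countable X] (hC : ∀ A ∈ C, Structure.FG L A)
    (hJ : JEP (classOf C)) (hW : WAP (classOf C)) {ι : Type*} [Countable ι]
    (D : ι → PSystem.{u, v, 0} L) [∀ q, Countable (D q).carrier] (hD : ∀ q, D q ∈ classOf C)
    (hcof : ∀ A ∈ classOf C, ∃ q, Nonempty (Emb A (D q))) :
    {y | IsRich (classOf C) (𝒮.sys y)} ∈ residual Ω := by
  classical
  have h₁ : ∀ᶠ y in residual Ω, ∀ q, Nonempty (Emb (D q) (𝒮.sys y)) := by
    refine eventually_countable_forall.2 fun q => ?_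
    have : {y | Nonempty (Emb (D q) (𝒮.sys y))} = 𝒮.realizing (D q) ∅ := by
      ext y
      exact ⟨fun ⟨g⟩ => ⟨g, by simp⟩, fun ⟨g, _⟩ => ⟨g⟩⟩
    refine residual_of_dense_open (this ▸ 𝒮.isOpen_realizing (hD q) _) ?_
    refine 𝒮.dense_of_forall_subsystem fun y A hA i => ?_
    obtain ⟨E, hE, ⟨f⟩, ⟨g⟩⟩ := hJ A hA (D q) (hD q)
    exact ⟨E, hE, f, fun z ⟨k⟩ => ⟨k.comp g⟩⟩
  have h₂ : ∀ᶠ y in residual Ω, ∀ s : Finset X, y ∈ 𝒮.amalgamating C s :=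
    eventually_countable_forall.2 fun s => residual_of_dense_open (𝒮.isOpen_amalgamating _)
      (𝒮.dense_amalgamating hC hW s.finite_toSet)
  have h₃ : ∀ᶠ y in residual Ω, ∀ q, ∀ p : Finset ((D q).carrier × X),
      y ∈ 𝒮.realizing (D q) p ∪ (_root_.closure (𝒮.realizing (D q) p))ᶜ :=
    eventually_countable_forall.2 fun q => eventually_countable_forall.2 fun p =>
      isOpen_union_compl_closure_mem_residual (𝒮.isOpen_realizing (hD q) _)
  filter_upwards [h₁, h₂, h₃] with y hy₁ hy₂ hy₃
  refine ⟨subset_antisymm (age_ofAut_subset (𝒮.age_subset y) _) fun A hA => ?_, fun s hs => ?_,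
    fun B hB B' hB' j h F hF hBF => ?_⟩
  · obtain ⟨q, ⟨f⟩⟩ := hcof A hA
    obtain ⟨g⟩ := hy₁ q
    exact mem_age_of_mem_classOf hC hA (g.comp f)
  · obtain ⟨B, hB, j, hsj, hj⟩ := hy₂ (hs.image (𝒮.idx y)).toFinset
    rw [Set.Finite.coe_toFinset] at hsj hj
    refine ⟨B, hB, j, fun x hx => ?_, ?_⟩
    · obtain ⟨b, hb⟩ := hsj ⟨x, hx, rfl⟩
      exact ⟨b, 𝒮.idx_injective y hb⟩
    · convert hj using 1
      ext b
      exact ((𝒮.idx_injective y).mem_set_image).symm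
  -- B' is replaced by a member of the countable cofinal family, and p prescribes the images of the
  -- points of F.
  · obtain ⟨q, ⟨k⟩⟩ := hcof B' hB'
    let p : Finset ((D q).carrier × X) := hF.toFinset.image fun b => (k (h b), 𝒮.idx y (j b))
    rcases hy₃ q p with ⟨g, hg⟩ | hy
    · refine ⟨g.comp k, fun b hb => 𝒮.idx_injective y ?_⟩
      exact hg (k (h b), 𝒮.idx y (j b))
        (Finset.mem_coe.2 (Finset.mem_image.2 ⟨b, hF.mem_toFinset.2 hb, rfl⟩))
    -- A neighbourhood of y avoiding the type is given by some A. Join A and B inside y to E,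
    -- amalgamate E with `D q` over F, and realize the result near y: this point lies in the
    -- neighbourhood and realizes p.
    · exfalso
      obtain ⟨A, hA, i, hi⟩ := 𝒮.exists_subset y _ (isClosed_closure.isOpen_compl.mem_nhds hy)
      obtain ⟨E, hE, d, e₁, e₂, he₁, he₂, -⟩ := exists_common_subsystem (𝒮.age_subset y)
        (hC _ hA.1) (hC _ hB.1) i j Set.finite_empty
      obtain ⟨G, hG, g₁, g₂, hg⟩ := hBF E hE (D q) (hD q) e₂ (k.comp h)
      obtain ⟨z, g, hz⟩ := 𝒮.exists_extension y E hE G hG d g₁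
      refine hi (a := z) ⟨(g.comp g₁).comp e₁, fun a => (hz _).trans (by rw [he₁])⟩
        (subset_closure ⟨g.comp g₂, fun c hc => ?_⟩)
      obtain ⟨b, hb, rfl⟩ := Finset.mem_image.1 (Finset.mem_coe.1 hc)
      have := hg b (hF.mem_toFinset.1 hb)
      calc 𝒮.idx z (g (g₂ (k (h b)))) = 𝒮.idx z (g (g₁ (e₂ b))) := by rw [this]; rfl
        _ = 𝒮.idx y (d (e₂ b)) := hz _
        _ = 𝒮.idx y (j b) := by rw [he₂]

end IndexedAutSpace

/-! ### Extending systems to automorphisms of M -/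

section Ultrahomogeneous

variable {L : FirstOrder.Language.{u, v}} {M : Type w} [L.Structure M]

/-- Any two copies of a finitely generated structure in an ultrahomogeneous structure are conjugate
under an automorphism. -/
theorem exists_aut_comp_eq (hM : L.IsUltrahomogeneous M) {A : Type*} [L.Structure A]
    (hA : Structure.FG L A) (i j : A ↪[L] M) : ∃ g : M ≃[L] M, ∀ a, g (i a) = j a := by
  obtain ⟨g, hg⟩ := hM i.toHom.range (hA.range i.toHom) (j.comp i.equivRange.symm.toEmbedding)
  refine ⟨g, fun a => ?_⟩
  have := DFunLike.congr_fun hg (i.equivRange a)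
  have h : i.equivRange.symm (i.equivRange a) = a := Equiv.symm_apply_apply _ _
  exact (this.symm.trans (congrArg j h))

/-- A system in the class of the age of `M` embeds into `(M, f)` for some automorphism `f`, with
prescribed values on a finitely generated substructure. -/
theorem exists_emb_ofAut (hM : L.IsUltrahomogeneous M) {A : Type*} [L.Structure A]
    (hA : Structure.FG L A) {D : PSystem.{u, v, w} L} (hD : D ∈ classOf (L.age M))
    (e : A ↪[L] D.carrier) (k : A ↪[L] M) :
    ∃ (f : M ≃[L] M) (g : Emb D (ofAut f)), ∀ a, g (e a) = k a := by
  obtain ⟨r⟩ := hD.1.2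
  obtain ⟨t, ht⟩ := exists_aut_comp_eq hM hA (r.comp e) k
  let g : D.carrier ↪[L] M := t.toEmbedding.comp r
  -- Ultrahomogeneity is used twice: t corrected the embedding on A, and now the partial map of D
  -- extends to an automorphism.
  obtain ⟨f, hf⟩ := exists_aut_comp_eq hM hD.2.1.1 (g.comp D.map.dom.subtype)
    ((g.comp D.map.cod.subtype).comp D.map.toEquiv.toEmbedding)
  exact ⟨f, Emb.toAut f g fun x => (hf x).symm, ht⟩

theorem exists_emb_ofAut_of_mem (hM : L.IsUltrahomogeneous M) {D : PSystem.{u, v, w} L}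
    (hD : D ∈ classOf (L.age M)) : ∃ f : M ≃[L] M, Nonempty (Emb D (ofAut f)) := by
  obtain ⟨k⟩ := hD.1.2
  obtain ⟨f, g, -⟩ := exists_emb_ofAut hM hD.1.1 hD (Embedding.refl L _) k
  exact ⟨f, ⟨g⟩⟩

theorem aut_eqOn_closure {N : Type*} [L.Structure N] {f g : N ≃[L] N} {s : Set N}
    (h : ∀ x ∈ s, f x = g x) {x : N} (hx : x ∈ Substructure.closure L s) : f x = g x :=
  Hom.eqOn_closure (f := f.toHom) (g := g.toHom) h hx

/-- An embedding into `(N, f)` is also one into `(N, g)` if `g` agrees with `f` on the image of a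
generating set. -/
theorem exists_emb_of_eqOn {N : Type w} [L.Structure N] {f g : N ≃[L] N}
    {A : PSystem.{u, v, w} L} (i : Emb A (ofAut f)) {G : Set A.carrier}
    (hG : Substructure.closure L G = ⊤) (h : ∀ a ∈ G, g (i.toEmb a) = f (i.toEmb a)) :
    ∃ j : Emb A (ofAut g), ∀ a, j a = i a := by
  have key : ∀ a, g (i.toEmb a) = f (i.toEmb a) := embedding_eq_of_eqOn hG
    (i := g.toEmbedding.comp (i.toEmb : A.carrier ↪[L] N))
    (j := f.toEmbedding.comp (i.toEmb : A.carrier ↪[L] N)) h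
  exact ⟨Emb.toAut g i.toEmb fun x => (i.comm_aut x).trans (key x).symm, fun _ => rfl⟩

/-- The class of systems over the age of a countable ultrahomogeneous structure has a countable
cofinal subfamily of countable systems. -/
theorem exists_countable_cofinal [Countable M] (hM : L.IsUltrahomogeneous M) :
    ∃ (ι : Type w) (_ : Countable ι) (D : ι → PSystem.{u, v, w} L),
      (∀ q, Countable (D q).carrier) ∧ (∀ q, D q ∈ classOf (L.age M)) ∧
        ∀ A ∈ classOf (L.age M), ∃ q, Nonempty (Emb A (D q)) := by
  classical
  let ι := {q : Finset (M × M) // ∃ f : M ≃[L] M, ∀ p ∈ q, f p.1 = p.2}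
  choose f hf using fun q : ι => q.2
  choose D hD d hd using fun q : ι => exists_subsystem_of_finite (subset_refl (L.age M)) (f q)
    (q.1.image Prod.fst).finite_toSet
  refine ⟨ι, inferInstance, D, fun q => ?_, hD, fun A hA => ?_⟩
  · obtain ⟨r⟩ := (hD q).1.2
    exact r.injective.countable
  · obtain ⟨f₀, ⟨i⟩⟩ := exists_emb_ofAut_of_mem hM hA
    obtain ⟨G, hGf, hG⟩ := Structure.fg_iff.1 hA.1.1
    let q : ι := ⟨hGf.toFinset.image fun a => (i.toEmb a, f₀ (i.toEmb a)), f₀, fun p hp => by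
      obtain ⟨a, -, rfl⟩ := Finset.mem_image.1 hp
      rfl⟩
    have hq : ∀ a ∈ G, ((i.toEmb a : M), f₀ (i.toEmb a)) ∈ q.1 := fun a ha =>
      Finset.mem_image.2 ⟨a, hGf.mem_toFinset.2 ha, rfl⟩
    obtain ⟨j, hj⟩ := exists_emb_of_eqOn (g := f q) i hG fun a ha => hf q _ (hq a ha)
    obtain ⟨e, -⟩ := exists_factor j (d q) hG fun a ha => by
      rw [hj]
      exact hd q _ (Finset.mem_coe.2 (Finset.mem_image.2 ⟨_, hq a ha, rfl⟩))
    exact ⟨q, ⟨e⟩⟩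

end Ultrahomogeneous

/-! ### The automorphism group as an indexed space -/

section AutGroup

variable {L : FirstOrder.Language.{u, v}} {M : Type} [L.Structure M]

theorem mem_nhds_autTopology_iff {f : M ≃[L] M} {O : Set (M ≃[L] M)} :
    O ∈ @nhds _ (autTopology L M) f ↔ ∃ s : Set M, s.Finite ∧
      {g : M ≃[L] M | ∀ x ∈ s, g x = f x} ⊆ O := by
  let _ : TopologicalSpace M := ⊥
  have : DiscreteTopology M := ⟨rfl⟩
  let _ := autTopology L M
  rw [nhds_induced, Filter.mem_comap]
  constructor
  · rintro ⟨U, hU, hUO⟩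
    rw [nhds_pi, Filter.mem_pi] at hU
    obtain ⟨s, hs, t, ht, hst⟩ := hU
    refine ⟨s, hs, fun g hg => hUO (hst fun x hx => ?_)⟩
    have h : f x ∈ t x := mem_of_mem_nhds (ht x)
    rw [← hg x hx] at h
    exact h
  · rintro ⟨s, hs, hsO⟩
    refine ⟨s.pi fun x => {f x}, set_pi_mem_nhds hs fun x _ => by simp, fun g hg => hsO ?_⟩
    exact fun x hx => hg x hx

/-- The automorphism group of an ultrahomogeneous structure. -/
def autIndexed (hM : L.IsUltrahomogeneous M) :
    letI := autTopology L M
    IndexedAutSpace (L.age M) (M ≃[L] M) M :=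
  letI := autTopology L M
  { carrier := fun _ => M
    aut := fun f => f
    index := fun _ => .refl M
    age_subset := fun _ => subset_rfl
    mem_nhds := fun f A hA i => by
      obtain ⟨G, hGf, hG⟩ := Structure.fg_iff.1 hA.1.1
      refine mem_nhds_autTopology_iff.2 ⟨_, hGf.image i, fun g hg => ?_⟩
      exact exists_emb_of_eqOn i hG fun a ha => hg _ ⟨a, ha, rfl⟩
    exists_subset := fun f O hO => by
      obtain ⟨s, hs, hsO⟩ := mem_nhds_autTopology_iff.1 hO
      obtain ⟨D, hD, d, hd⟩ := exists_subsystem_of_finite (subset_refl (L.age M)) f hs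
      refine ⟨D, hD, d, fun g ⟨j, hj⟩ => hsO fun x hx => ?_⟩
      obtain ⟨c, hc, rfl⟩ := hd x hx
      have h₁ := j.comm_aut ⟨c, hc⟩
      have h₂ := d.comm_aut ⟨c, hc⟩
      have hj' : ∀ a, j.toEmb a = d.toEmb a := hj
      rw [hj', hj', h₂] at h₁
      exact h₁.symm
    exists_extension := fun f A hA D hD i e => exists_emb_ofAut hM hA.1.1 hD e.toEmb i.toEmb }

end AutGroup

/-! ### Back and forth between rich systems -/

/-- A back-and-forth system of finite partial injections between countable types contains
arbitrarily large finite parts of a bijection. -/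
theorem exists_equiv_of_back_and_forth {X Y : Type*} [Countable X] [Countable Y]
    (R : Finset (X × Y) → Prop) (hinj : ∀ r, R r → ∀ p ∈ r, ∀ q ∈ r, p.1 = q.1 ↔ p.2 = q.2)
    (forth : ∀ r, R r → ∀ x, ∃ y r', R r' ∧ r ⊆ r' ∧ (x, y) ∈ r')
    (back : ∀ r, R r → ∀ y, ∃ x r', R r' ∧ r ⊆ r' ∧ (x, y) ∈ r')
    {r₀ : Finset (X × Y)} (h₀ : R r₀) :
    ∃ e : X ≃ Y, (∀ p ∈ r₀, e p.1 = p.2) ∧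
      ∀ s : Set X, s.Finite → ∃ r, R r ∧ ∀ x ∈ s, (x, e x) ∈ r := by
  classical
  let P := {r // R r}
  let _ := Encodable.ofCountable X
  let _ := Encodable.ofCountable Y
  let 𝒟 : X ⊕ Y → Order.Cofinal P := Sum.elim
    (fun x => ⟨{r | ∃ y, (x, y) ∈ r.1}, fun r => by
      obtain ⟨y, r', h, hle, hm⟩ := forth r.1 r.2 x
      exact ⟨⟨r', h⟩, ⟨y, hm⟩, hle⟩⟩)
    (fun y => ⟨{r | ∃ x, (x, y) ∈ r.1}, fun r => by
      obtain ⟨x, r', h, hle, hm⟩ := back r.1 r.2 y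
      exact ⟨⟨r', h⟩, ⟨x, hm⟩, hle⟩⟩)
  let I := Order.idealOfCofinals (⟨r₀, h₀⟩ : P) 𝒟
  have hX : ∀ x, ∃ y, ∃ r ∈ I, (x, y) ∈ r.1 := fun x => by
    obtain ⟨r, ⟨y, hy⟩, hr⟩ := Order.cofinal_meets_idealOfCofinals (⟨r₀, h₀⟩ : P) 𝒟 (Sum.inl x)
    exact ⟨y, r, hr, hy⟩
  have hY : ∀ y, ∃ x, ∃ r ∈ I, (x, y) ∈ r.1 := fun y => by
    obtain ⟨r, ⟨x, hx⟩, hr⟩ := Order.cofinal_meets_idealOfCofinals (⟨r₀, h₀⟩ : P) 𝒟 (Sum.inr y)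
    exact ⟨x, r, hr, hx⟩
  have key : ∀ r ∈ I, ∀ r' ∈ I, ∀ p ∈ r.1, ∀ q ∈ r'.1, p.1 = q.1 ↔ p.2 = q.2 := by
    intro r hr r' hr' p hp q hq
    obtain ⟨t, -, h₁, h₂⟩ := I.directed r hr r' hr'
    exact hinj t.1 t.2 p (h₁ hp) q (h₂ hq)
  choose f rf hrf hf using hX
  choose g rg hrg hg using hY
  refine ⟨⟨f, g, fun x => ?_, fun y => ?_⟩, fun p hp => ?_, fun s hs => ?_⟩
  · exact (key _ (hrg (f x)) _ (hrf x) _ (hg _) _ (hf _)).2 rfl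
  · exact (key _ (hrf (g y)) _ (hrg y) _ (hf _) _ (hg _)).1 rfl
  · exact (key _ (hrf p.1) _ (Order.mem_idealOfCofinals _ _) _ (hf _) p hp).1 rfl
  -- The ideal is directed, so finitely many pairs of the bijection lie in a single approximation.
  · suffices ∃ r ∈ I, ∀ x ∈ s, (x, f x) ∈ r.1 from
      let ⟨r, _, h⟩ := this
      ⟨r.1, r.2, h⟩
    induction s, hs using Set.Finite.induction_on with
    | empty => exact ⟨_, Order.mem_idealOfCofinals _ _, by simp⟩
    | @insert x s _ _ ih =>
      obtain ⟨r, hr, h⟩ := ih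
      obtain ⟨t, ht, h₁, h₂⟩ := I.directed r hr _ (hrf x)
      refine ⟨t, ht, ?_⟩
      rintro z (rfl | hz)
      · exact h₂ (hf z)
      · exact h₁ (h z hz)

namespace PSystem

variable {L : FirstOrder.Language.{u, v}} {C : Set (Bundled.{w} L.Structure)}
  {M N : Type w} [L.Structure M] [L.Structure N] {f : M ≃[L] M} {g : N ≃[L] N}

/-- In a rich system, every subsystem is contained in one over which amalgamation is possible and
whose domain contains a given finite set. -/
theorem IsRich.exists_amalgamating (hN : L.age N ⊆ C) (hC : ∀ A ∈ C, Structure.FG L A)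
    (hg : IsRich (classOf C) (ofAut g)) {A : PSystem.{u, v, w} L} (hA : A ∈ classOf C)
    (i : Emb A (ofAut g)) {s : Set N} (hs : s.Finite) :
    ∃ B ∈ classOf C, ∃ (e : Emb A B) (j : Emb B (ofAut g)) (F : Set B.carrier), F.Finite ∧
      AmalgamatesOver (classOf C) B F ∧ (∀ a, j (e a) = i a) ∧ (∀ b ∈ F, b ∈ B.map.dom) ∧
      (∀ b, j b ∈ s → b ∈ F) ∧ ∀ x ∈ s, ∃ b ∈ F, j b = x := by
  obtain ⟨B₀, hB₀, j₀, hs₀, hj₀⟩ := hg.cofinal s hs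
  obtain ⟨B, hB, j, e, k, he, hk, hj⟩ := exists_common_subsystem hN (hC _ hA.1) (hC _ hB₀.1) i j₀ hs
  have hF : ∀ b, j b ∈ s → ∃ c, j₀ c ∈ s ∧ k c = b := fun b hb => by
    obtain ⟨c, hc⟩ := hs₀ hb
    exact ⟨c, hc ▸ hb, j.injective ((hk c).trans hc)⟩
  refine ⟨B, hB, e, j, j ⁻¹' s, hs.preimage j.injective.injOn, hj₀.of_emb k hF, he,
    fun b hb => ?_, fun b hb => hb, fun x hx => ?_⟩
  · obtain ⟨c, hc, hcb⟩ := hj _ hb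
    rwa [← j.injective hcb]
  · obtain ⟨c, -, hc⟩ := hj x hx
    refine ⟨c, ?_, hc⟩
    rw [← hc] at hx
    exact hx

/-- The finite relation `r` comes from two copies of a single system which amalgamates over the
points in question. -/
def Linked (C : Set (Bundled.{w} L.Structure)) (f : M ≃[L] M) (g : N ≃[L] N)
    (r : Set (M × N)) : Prop :=
  ∃ B ∈ classOf C, ∃ (j : Emb B (ofAut f)) (k : Emb B (ofAut g)) (F : Set B.carrier), F.Finite ∧
    AmalgamatesOver (classOf C) B F ∧ (∀ b ∈ F, b ∈ B.map.dom) ∧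
    ∀ p ∈ r, ∃ b ∈ F, j b = p.1 ∧ k b = p.2

theorem Linked.swap {r : Set (M × N)} (h : Linked C f g r) : Linked C g f (Prod.swap ⁻¹' r) :=
  let ⟨B, hB, j, k, F, hF, hBF, hd, hr⟩ := h
  ⟨B, hB, k, j, F, hF, hBF, hd, fun _ hp =>
    let ⟨b, hb, h₁, h₂⟩ := hr _ hp
    ⟨b, hb, h₂, h₁⟩⟩

/-- Enlarge the copy of B in M to an amalgamating copy of B' around x and the old points, then
realize B' in N. Only the points of F are guaranteed to stay in place, which is all that the old
pairs use. -/
theorem Linked.forth {r : Set (M × N)} (h : Linked C f g r) (hM : L.age M ⊆ C)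
    (hC : ∀ A ∈ C, Structure.FG L A) (hf : IsRich (classOf C) (ofAut f))
    (hg : IsRich (classOf C) (ofAut g)) (x : M) : ∃ y, Linked C f g (insert (x, y) r) := by
  obtain ⟨B, hB, j, k, F, hF, hBF, hd, hr⟩ := h
  obtain ⟨B', hB', e, j', F', hF', hBF', he, hd', hFs, hx⟩ := hf.exists_amalgamating hM hC hB j
    ((Set.finite_singleton x).union (hF.image j))
  obtain ⟨l, hl⟩ := hg.extension B hB B' hB' k e F hF hBF
  obtain ⟨b₀, hb₀, hb₀x⟩ := hx x (Or.inl rfl)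
  refine ⟨l b₀, B', hB', j', l, F', hF', hBF', hd', ?_⟩
  rintro p (rfl | hp)
  · exact ⟨b₀, hb₀, hb₀x, rfl⟩
  · obtain ⟨b, hb, h₁, h₂⟩ := hr p hp
    exact ⟨e b, hFs _ (Or.inr ⟨b, hb, (he b).symm⟩), (he b).trans h₁, (hl b hb).trans h₂⟩

/-- Two countable rich systems are isomorphic, by an isomorphism which extends a given finite
linked relation. -/
theorem Linked.exists_equiv [Countable M] [Countable N] {r : Set (M × N)} (h : Linked C f g r)
    (hrf : r.Finite) (hM : L.age M ⊆ C) (hN : L.age N ⊆ C) (hC : ∀ A ∈ C, Structure.FG L A)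
    (hf : IsRich (classOf C) (ofAut f)) (hg : IsRich (classOf C) (ofAut g)) :
    ∃ e : M ≃[L] N, (∀ p ∈ r, e p.1 = p.2) ∧ ∀ x, e (f x) = g (e x) := by
  classical
  refine Exists.elim (exists_equiv_of_back_and_forth (fun r => Linked C f g (r : Set (M × N)))
    ?_ ?_ ?_ (r₀ := hrf.toFinset) (by simpa using h)) ?_
  · rintro r ⟨B, hB, j, k, G, hG, hBG, hd, hr⟩ p hp q hq
    obtain ⟨b, -, hb₁, hb₂⟩ := hr p hp
    obtain ⟨c, -, hc₁, hc₂⟩ := hr q hq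
    rw [← hb₁, ← hb₂, ← hc₁, ← hc₂]
    exact j.injective.eq_iff.trans k.injective.eq_iff.symm
  · intro r hr x
    obtain ⟨y, hy⟩ := hr.forth hM hC hf hg x
    exact ⟨y, insert (x, y) r, by simpa using hy, Finset.subset_insert _ _,
      Finset.mem_insert_self _ _⟩
  · intro r hr y
    obtain ⟨x, hx⟩ := hr.swap.forth hN hC hg hf y
    refine ⟨x, insert (x, y) r, ?_, Finset.subset_insert _ _, Finset.mem_insert_self _ _⟩
    convert hx.swap using 1
    ext p
    simp [Prod.ext_iff, and_comm]
  · rintro e ⟨her, he⟩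
    refine ⟨⟨e, fun {n} F xs => ?_, fun {n} R xs => ?_⟩, fun p hp => her p (by simpa using hp),
      fun x => ?_⟩
    · obtain ⟨r, ⟨B, hB, j, k, G, hG, hBG, hd, hr⟩, hs⟩ := he
        (insert (Structure.funMap F xs) (Set.range xs)) ((Set.finite_range xs).insert _)
      have H : ∀ x ∈ insert (Structure.funMap F xs) (Set.range xs), ∃ b, j.toEmb b = x ∧
          k.toEmb b = e x := fun x hx => by
        obtain ⟨b, -, hb⟩ := hr _ (hs x hx)
        exact ⟨b, hb⟩
      choose b hbj hbk using fun i => H (xs i) (Or.inr ⟨i, rfl⟩)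
      obtain ⟨c, hcj, hck⟩ := H _ (Or.inl rfl)
      have hc : c = Structure.funMap F b := j.injective <| by
        refine hcj.trans ?_
        refine Eq.trans ?_ (HomClass.map_fun j.toEmb F b).symm
        congr 1
        exact funext fun i => (hbj i).symm
      refine hck.symm.trans ?_
      rw [hc]
      refine (HomClass.map_fun k.toEmb F b).trans ?_
      congr 1
      exact funext hbk
    · obtain ⟨r, ⟨B, hB, j, k, G, hG, hBG, hd, hr⟩, hs⟩ := he _ (Set.finite_range xs)
      have H : ∀ x ∈ Set.range xs, ∃ b, j.toEmb b = x ∧ k.toEmb b = e x := fun x hx => by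
        obtain ⟨b, -, hb⟩ := hr _ (hs x hx)
        exact ⟨b, hb⟩
      choose b hbj hbk using fun i => H (xs i) ⟨i, rfl⟩
      have h₁ : j.toEmb ∘ b = xs := funext hbj
      have h₂ : k.toEmb ∘ b = e ∘ xs := funext hbk
      have h₃ := StrongHomClass.map_rel j.toEmb R b
      have h₄ := StrongHomClass.map_rel k.toEmb R b
      rw [h₁] at h₃
      rw [h₂] at h₄
      exact h₄.trans h₃.symm
    -- Both x and f x come from one B, and the preimage b of x is in its domain. Hence f x comes
    -- from the image of b under the partial map, and k carries this to g.
    · obtain ⟨r, ⟨B, hB, j, k, G, hG, hBG, hd, hr⟩, hs⟩ := he {x, f x} (Set.toFinite _)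
      obtain ⟨b, hb, hbj, hbk⟩ := hr _ (hs x (Or.inl rfl))
      obtain ⟨c, hc, hcj, hck⟩ := hr _ (hs (f x) (Or.inr rfl))
      have h₁ := j.comm_aut ⟨b, hd b hb⟩
      have h₂ := k.comm_aut ⟨b, hd b hb⟩
      have : c = (B.map.toEquiv ⟨b, hd b hb⟩ : B.carrier) :=
        j.injective (hcj.trans (((congrArg f hbj).symm).trans h₁.symm))
      refine hck.symm.trans ?_
      rw [this]
      exact h₂.trans (congrArg g hbk)

/-- An isomorphism of structures commuting with automorphisms, as an isomorphism of systems. -/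
def Iso.ofEquiv (e : M ≃[L] N) (he : ∀ x, e (f x) = g (e x)) : Iso (ofAut f) (ofAut g) where
  hom := Emb.toAut (S := ofAut f) g e.toEmbedding fun x => he x.1
  inv := Emb.toAut (S := ofAut g) f e.symm.toEmbedding fun x => by
    refine e.injective ?_
    refine Eq.trans ?_ (he _).symm
    refine (e.apply_symm_apply _).trans ?_
    exact congrArg g (e.apply_symm_apply _).symm
  left_inv x := e.symm_apply_apply x
  right_inv x := e.apply_symm_apply x

theorem IsRich.nonempty_iso [Countable M] [Countable N] (hM : L.age M ⊆ C) (hN : L.age N ⊆ C)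
    (hC : ∀ A ∈ C, Structure.FG L A) (hf : IsRich (classOf C) (ofAut f))
    (hg : IsRich (classOf C) (ofAut g)) : ∃ e : M ≃[L] N, ∀ x, e (f x) = g (e x) := by
  obtain ⟨B, hB, j, -, hj⟩ := hf.cofinal ∅ Set.finite_empty
  obtain ⟨k⟩ := hg.nonempty_emb hB
  have : Linked C f g ∅ := ⟨B, hB, j, k, ∅, Set.finite_empty, hj, by simp, by simp⟩
  obtain ⟨e, -, he⟩ := this.exists_equiv Set.finite_empty hM hN hC hf hg
  exact ⟨e, he⟩

/-- Amalgamation over F is a property of B alone, so any two copies of B in (M, f) are linked along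
F, and F contains generators of A. -/
theorem IsRich.weaklyHomogeneousEverywhere [Countable M] (hM : L.age M ⊆ C)
    (hC : ∀ A ∈ C, Structure.FG L A) (hf : IsRich (classOf C) (ofAut f)) :
    WeaklyHomogeneousEverywhere (classOf C) (ofAut f) := by
  intro A hA i
  obtain ⟨G, hGf, hG⟩ := Structure.fg_iff.1 (hC _ hA.1)
  obtain ⟨B, hB, e, j, F, hF, hBF, he, hd, hFs, hx⟩ := hf.exists_amalgamating hM hC hA i
    (hGf.image i)
  refine ⟨B, hB, e, j, he, fun h₁ h₂ => ?_⟩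
  have : Linked C f f ((fun b => (h₁ b, h₂ b)) '' F) :=
    ⟨B, hB, h₁, h₂, F, hF, hBF, hd, by rintro _ ⟨b, hb, rfl⟩; exact ⟨b, hb, rfl, rfl⟩⟩
  obtain ⟨σ, hσ, hcomm⟩ := this.exists_equiv (hF.image _) hM hM hC hf hf
  refine ⟨Iso.ofEquiv σ hcomm, embedding_eq_of_eqOn hG
    (i := ((σ.toEmbedding.comp (h₁.toEmb : B.carrier ↪[L] M)).comp e.toEmb : A.carrier ↪[L] M))
    (j := (h₂.toEmb : B.carrier ↪[L] M).comp e.toEmb) fun a ha => ?_⟩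
  exact hσ _ ⟨e a, hFs _ ⟨a, ha, (he a).symm⟩, rfl⟩

theorem WeaklyHomogeneousEverywhere.weaklyHomogeneous {K : Set (PSystem.{u, v, w} L)}
    {X : PSystem.{u, v, w} L} (hX : WeaklyHomogeneousEverywhere K X)
    (h : ∀ A ∈ K, Nonempty (Emb A X)) : WeaklyHomogeneous K X := fun A hA =>
  let ⟨i⟩ := h A hA
  let ⟨B, hB, e, _, _, he⟩ := hX A hA i
  ⟨B, hB, e, he⟩

theorem IsRich.isWeakFraisseLimit [Countable M] (hM : L.age M ⊆ C)
    (hC : ∀ A ∈ C, Structure.FG L A) (hf : IsRich (classOf C) (ofAut f)) :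
    IsWeakFraisseLimit (classOf C) (ofAut f) :=
  ⟨‹Countable M›, hf.age_eq, (hf.weaklyHomogeneousEverywhere hM hC).weaklyHomogeneous
    fun _ => hf.nonempty_emb⟩

end PSystem

/-! ### Transport of systems, and the space of pairs -/

namespace PSystem

variable {L : FirstOrder.Language.{u, v}} (S : PSystem.{u, v, w} L) {R : Type w} [L.Structure R]
  (E : S.carrier ≃[L] R)

/-- The partial map of a system, transported along an isomorphism of the underlying structure. -/
noncomputable def transportMap : L.PartialEquiv R R where
  dom := S.map.dom.map E.toEmbedding.toHom
  cod := S.map.cod.map E.toEmbedding.toHom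
  toEquiv := ((E.toEmbedding.substructureEquivMap S.map.cod).comp S.map.toEquiv).comp
    (E.toEmbedding.substructureEquivMap S.map.dom).symm

theorem transportMap_apply (x : S.map.dom) :
    ((S.transportMap E).toEquiv ⟨E x, x, x.2, rfl⟩ : R) = E (S.map.toEquiv x : S.carrier) := by
  have h : (E.toEmbedding.substructureEquivMap S.map.dom).symm ⟨E x, x, x.2, rfl⟩ = x :=
    (E.toEmbedding.substructureEquivMap S.map.dom).symm_apply_apply x
  exact congrArg (fun y : S.map.dom => E (S.map.toEquiv y : S.carrier)) h

/-- A system is isomorphic to its transport along an isomorphism of the underlying structure. -/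
noncomputable def transportIso : Iso S (mk R (S.transportMap E)) where
  hom :=
    { toEmb := E.toEmbedding
      map_dom := fun x hx => ⟨x, hx, rfl⟩
      map_cod := fun x hx => ⟨x, hx, rfl⟩
      comm := fun x => (S.transportMap_apply E x).symm }
  inv :=
    { toEmb := E.symm.toEmbedding
      map_dom := by
        rintro _ ⟨x, hx, rfl⟩
        exact (E.symm_apply_apply x).symm ▸ hx
      map_cod := by
        rintro _ ⟨x, hx, rfl⟩
        exact (E.symm_apply_apply x).symm ▸ hx
      comm := by
        rintro ⟨_, x, hx, rfl⟩
        have h₁ : E.symm (E x) = x := E.symm_apply_apply x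
        refine (congrArg E.symm (S.transportMap_apply E ⟨x, hx⟩)).trans ?_
        refine (E.symm_apply_apply _).trans ?_
        congr 2
        exact Subtype.ext h₁.symm }
  left_inv x := E.symm_apply_apply x
  right_inv x := E.apply_symm_apply x

end PSystem

theorem exists_equiv_comp_eq {A M N : Type*} [Countable M] [Countable N] {k : A → M} {i : A → N}
    (hk : k.Injective) (hi : i.Injective) (hk' : (Set.range k)ᶜ.Infinite)
    (hi' : (Set.range i)ᶜ.Infinite) : ∃ π : M ≃ N, ∀ a, π (k a) = i a := by
  classical
  have := hk'.to_subtype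
  have := hi'.to_subtype
  obtain ⟨e⟩ := nonempty_equiv_of_countable (α := ↥(Set.range k)ᶜ) (β := ↥(Set.range i)ᶜ)
  refine ⟨(_root_.Equiv.Set.sumCompl (Set.range k)).symm.trans ((_root_.Equiv.sumCongr
    ((_root_.Equiv.ofInjective k hk).symm.trans (_root_.Equiv.ofInjective i hi)) e).trans
    (_root_.Equiv.Set.sumCompl (Set.range i))), fun a => ?_⟩
  have h : (_root_.Equiv.Set.sumCompl (Set.range k)).symm (k a) = Sum.inl ⟨k a, a, rfl⟩ :=
    _root_.Equiv.Set.sumCompl_symm_apply_of_mem (Set.mem_range_self a)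
  have h' : (_root_.Equiv.ofInjective k hk).symm ⟨k a, a, rfl⟩ = a :=
    _root_.Equiv.ofInjective_symm_apply hk a
  simp [h, h']

/-- A finite complement, added to generators of A, would generate N. The infinite complement leaves
room to extend an enumeration of A to one of N. -/
theorem infinite_compl_range_of_not_fg {L : FirstOrder.Language.{u, v}} {A N : Type*}
    [L.Structure A] [L.Structure N] (hA : Structure.FG L A) (hN : ¬ Structure.FG L N)
    (i : A ↪[L] N) : (Set.range i)ᶜ.Infinite := by
  intro hfin
  obtain ⟨G, hGf, hG⟩ := Structure.fg_iff.1 (hA)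
  refine hN (Structure.fg_iff.2 ⟨i '' G ∪ (Set.range i)ᶜ, (hGf.image i).union hfin, ?_⟩)
  refine eq_top_iff.2 fun x _ => ?_
  by_cases hx : x ∈ Set.range i
  · obtain ⟨a, rfl⟩ := hx
    have h : Substructure.closure L G ≤
        (Substructure.closure L (i '' G ∪ (Set.range i)ᶜ)).comap i.toHom :=
      Substructure.closure_le.2 fun a ha => Substructure.subset_closure (Or.inl ⟨a, ha, rfl⟩)
    exact h (by rw [hG]; trivial : a ∈ Substructure.closure L G)
  · exact Substructure.subset_closure (Or.inr hx)

namespace AutSpace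

variable {L : FirstOrder.Language.{u, v}} {C : Set (Bundled.{0} L.Structure)}

/-- The value of an embedding into a point of the space, as a natural number. -/
def val {A : PSystem.{u, v, 0} L} {Y : AutSpace C} (i : Emb A Y.toPSystem) (a : A.carrier) : ℕ :=
  i a

/-- Transporting A to its range in ω turns the set into one of the generators of the topology. -/
theorem mem_nhds_of_emb (Y : AutSpace C) {A : PSystem.{u, v, 0} L} (hA : A ∈ classOf C)
    (hC : ∀ A ∈ C, Structure.FG L A) (i : Emb A Y.toPSystem) :
    {Z : AutSpace C | ∃ j : Emb A Z.toPSystem, ∀ a, val j a = val i a} ∈ 𝓝 Y := by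
  have hi : Function.Injective (val i) := i.injective
  let e := _root_.Equiv.ofInjective (val i) hi
  let _ : L.Structure (Set.range (val i)) := e.inducedStructure
  let E : A.carrier ≃[L] Set.range (val i) := e.inducedStructureEquiv
  have hEA : ∀ a : Set.range (val i), val i (E.symm a) = a := fun a =>
    congrArg Subtype.val (e.apply_symm_apply a)
  have hE : ∀ a, (E a : ℕ) = val i a := fun a => rfl
  have hmem : PSystem.mk (L := L) (Set.range (val i)) (A.transportMap E) ∈ classOf C := by
    let _ := Y.str
    have iN : A.carrier ↪[L] ℕ := i.toEmb
    refine mem_classOf_of_embedding (N := ℕ) Y.age_subset (E.fg_iff.1 (hC _ hA.1))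
      (((Substructure.fg_iff_structure_fg _).2 (hC _ hA.2.1)).map _) ?_
    exact iN.comp E.symm.toEmbedding
  have hopen : IsOpen (basicOpen C (Set.range (val i)) (A.transportMap E)) :=
    TopologicalSpace.isOpen_generateFrom_of_mem ⟨_, _, _, hmem, rfl⟩
  refine Filter.mem_of_superset (hopen.mem_nhds ⟨i.comp (A.transportIso E).inv, hEA⟩) ?_
  rintro Z ⟨j, hj⟩
  exact ⟨j.comp (A.transportIso E).hom, fun a => (hj _).trans (hE a)⟩

/-- The generating sets form a base: two subsystems of the same pair lie in a common one, which
handles intersections. -/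
theorem exists_subset_of_mem_nhds (hC : ∀ A ∈ C, Structure.FG L A) (Y : AutSpace C)
    {O : Set (AutSpace C)} (hO : O ∈ 𝓝 Y) : ∃ A ∈ classOf C, ∃ i : Emb A Y.toPSystem,
      {Z : AutSpace C | ∃ j : Emb A Z.toPSystem, ∀ a, val j a = val i a} ⊆ O := by
  let _ := Y.str
  obtain ⟨U, hUO, hU, hYU⟩ := mem_nhds_iff.1 hO
  suffices ∃ A ∈ classOf C, ∃ i : Emb A Y.toPSystem,
      {Z : AutSpace C | ∃ j : Emb A Z.toPSystem, ∀ a, val j a = val i a} ⊆ U from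
    let ⟨A, hA, i, hi⟩ := this
    ⟨A, hA, i, hi.trans hUO⟩
  clear hUO hO
  induction hU with
  | basic U hU =>
    obtain ⟨A, _, ψ, hA, rfl⟩ := hU
    obtain ⟨i, hi⟩ := hYU
    exact ⟨_, hA, i, fun Z ⟨j, hj⟩ => ⟨j, fun a => (hj a).trans (hi a)⟩⟩
  | univ =>
    obtain ⟨A, hA, i, -⟩ := exists_subsystem_of_finite Y.age_subset Y.aut Set.finite_empty
    exact ⟨A, hA, i, Set.subset_univ _⟩
  | inter U V _ _ ihU ihV =>
    obtain ⟨A, hA, i, hi⟩ := ihU hYU.1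
    obtain ⟨B, hB, j, hj⟩ := ihV hYU.2
    obtain ⟨D, hD, d, e, k, he, hk, -⟩ := exists_common_subsystem Y.age_subset (hC _ hA.1)
      (hC _ hB.1) i j Set.finite_empty
    refine ⟨D, hD, d, fun Z ⟨l, hl⟩ => ⟨hi ⟨l.comp e, fun a => ?_⟩, hj ⟨l.comp k, fun a => ?_⟩⟩⟩
    · exact (hl _).trans (he a)
    · exact (hl _).trans (hk a)
  | sUnion 𝒰 _ ih =>
    obtain ⟨U, hU, hYU⟩ := hYU
    obtain ⟨A, hA, i, hi⟩ := ih U hU hYU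
    exact ⟨A, hA, i, hi.trans (Set.subset_sUnion_of_mem hU)⟩

variable {M : Type} [L.Structure M]

/-- The point of the space obtained from an automorphism of `M` and an enumeration of `M`. -/
def ofEquiv (hfg : ¬ Structure.FG L M) (π : M ≃ ℕ) (f : M ≃[L] M) : AutSpace (L.age M) :=
  letI := π.inducedStructure (L := L)
  letI E : M ≃[L] ℕ := π.inducedStructureEquiv
  { str := inferInstance
    age_subset := E.age_eq_age.ge
    not_fg := fun h => hfg (E.fg_iff.2 h)
    aut := E.comp (f.comp E.symm) }

/-- The isomorphism from `(M, f)` to the associated point of the space. -/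
def isoOfEquiv (hfg : ¬ Structure.FG L M) (π : M ≃ ℕ) (f : M ≃[L] M) :
    Iso (ofAut f) (ofEquiv hfg π f).toPSystem :=
  letI := π.inducedStructure (L := L)
  letI E : M ≃[L] ℕ := π.inducedStructureEquiv
  Iso.ofEquiv (g := E.comp (f.comp E.symm)) E fun x => by
    change E (f x) = E (f (E.symm (E x)))
    rw [E.symm_apply_apply]

/-- Every extension of a subsystem of a point is realized by a point coming from `M`, and this can
be done with a prescribed enumeration of the subsystem. -/
theorem exists_extension [Countable M] (hM : L.IsUltrahomogeneous M) (hfg : ¬ Structure.FG L M)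
    (Y : AutSpace (L.age M)) {A D : PSystem.{u, v, 0} L} (hA : A ∈ classOf (L.age M))
    (hD : D ∈ classOf (L.age M)) (i : Emb A Y.toPSystem) (e : Emb A D) (k : A.carrier ↪[L] M) :
    ∃ (π : M ≃ ℕ) (f : M ≃[L] M) (g : Emb D (ofAut f)),
      (∀ a, g (e a) = k a) ∧ ∀ a, π (k a) = val i a := by
  obtain ⟨f, g, hg⟩ := exists_emb_ofAut hM hA.1.1 hD e.toEmb k
  obtain ⟨π, hπ⟩ := exists_equiv_comp_eq (i := val i) k.injective i.injective
    (infinite_compl_range_of_not_fg hA.1.1 hfg k)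
    (letI := Y.str
     infinite_compl_range_of_not_fg (N := ℕ) hA.1.1 Y.not_fg i.toEmb)
  exact ⟨π, f, g, hg, hπ⟩

/-- The space of pairs `(N, h)`, indexed by `ℕ`. -/
def indexed [Countable M] (hM : L.IsUltrahomogeneous M) (hfg : ¬ Structure.FG L M) :
    IndexedAutSpace (L.age M) (AutSpace (L.age M)) ℕ where
  carrier _ := ℕ
  str Y := Y.str
  aut Y := Y.aut
  index _ := .refl ℕ
  age_subset Y := Y.age_subset
  mem_nhds Y _ hA i := Y.mem_nhds_of_emb hA (fun _ h => h.1) i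
  exists_subset Y _ hO := exists_subset_of_mem_nhds (fun _ h => h.1) Y hO
  exists_extension Y A hA D hD i e := by
    obtain ⟨k⟩ := hA.1.2
    obtain ⟨π, f, g, hg, hπ⟩ := exists_extension hM hfg Y hA hD i e k
    exact ⟨ofEquiv hfg π f, (isoOfEquiv hfg π f).hom.comp g, fun a =>
      (congrArg π (hg a)).trans (hπ a)⟩

end AutSpace

/-! ### Comeager sets are nonempty -/

/-- Baire category for a complete decreasing sequence of equivalence relations. -/
theorem exists_forall_mem_of_complete {T : Type*} (r : ℕ → T → T → Prop)
    (refl : ∀ n a, r n a a) (trans : ∀ n a b c, r n a b → r n b c → r n a c)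
    (mono : ∀ m n a b, m ≤ n → r n a b → r m a b)
    (complete : ∀ t : ℕ → T, (∀ m n, n ≤ m → r n (t m) (t n)) → ∃ a, ∀ n, r n a (t n))
    (O : ℕ → Set T)
    (hO : ∀ n t m, ∃ t', r m t' t ∧ ∃ k, ∀ t'', r k t'' t' → t'' ∈ O n) (t₀ : T) (m₀ : ℕ) :
    ∃ a, r m₀ a t₀ ∧ ∀ n, a ∈ O n := by
  choose F hF k hk using hO
  -- The second component is the current precision. It strictly increases and is at least what
  -- membership in `O n` requires.
  let s : ℕ → T × ℕ := Nat.rec (t₀, m₀)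
    fun n p => (F n p.1 p.2, max (k n p.1 p.2) (p.2 + 1))
  have hs : ∀ n, r (s n).2 (s (n + 1)).1 (s n).1 := fun n => hF n _ _
  have hlt : ∀ n, (s n).2 < (s (n + 1)).2 := fun n => lt_of_lt_of_le (Nat.lt_succ_self _)
    (le_max_right _ _)
  have hmono : StrictMono fun n => (s n).2 := strictMono_nat_of_lt_succ hlt
  have hs' : ∀ m n, n ≤ m → r (s n).2 (s m).1 (s n).1 := by
    intro m n hnm
    induction m, hnm using Nat.le_induction with
    | base => exact refl _ _
    | succ m hnm ih => exact trans _ _ _ _ (mono _ _ _ _ (hmono.monotone hnm) (hs m)) ih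
  obtain ⟨a, ha⟩ := complete (fun n => (s n).1)
    fun m n h => mono _ _ _ _ hmono.le_apply (hs' m n h)
  have ha' : ∀ n, r (s n).2 a (s n).1 := fun n =>
    trans _ _ _ _ (mono _ _ _ _ (le_max_right n _) (ha _)) (hs' _ _ (le_max_left _ _))
  refine ⟨a, ha' 0, fun n => hk n (s n).1 (s n).2 a ?_⟩
  exact mono _ _ _ _ (le_max_left _ _) (ha' (n + 1))

open Filter in
-- Convergence of the inverses is needed too: a pointwise limit of bijections is injective but may
-- fail to be onto.
theorem exists_limit_equiv {X Y : Type*} (e : ℕ → X ≃ Y)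
    (h : ∀ x, ∃ y, ∀ᶠ m in atTop, e m x = y) (h' : ∀ y, ∃ x, ∀ᶠ m in atTop, (e m).symm y = x) :
    ∃ a : X ≃ Y, (∀ x, ∀ᶠ m in atTop, e m x = a x) ∧
      ∀ y, ∀ᶠ m in atTop, (e m).symm y = a.symm y := by
  choose f hf using h
  choose g hg using h'
  refine ⟨⟨f, g, fun x => ?_, fun y => ?_⟩, hf, hg⟩
  · obtain ⟨m, h₁, h₂⟩ := ((hf x).and (hg (f x))).exists
    rw [← h₂, ← h₁, _root_.Equiv.symm_apply_apply]
  · obtain ⟨m, h₁, h₂⟩ := ((hg y).and (hf (g y))).exists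
    rw [← h₂, ← h₁, _root_.Equiv.apply_symm_apply]

open Filter in
theorem exists_limit_aut {L : FirstOrder.Language.{u, v}} {M : Type*} [L.Structure M]
    (f : ℕ → M ≃[L] M) (h : ∀ x, ∃ y, ∀ᶠ m in atTop, f m x = y)
    (h' : ∀ y, ∃ x, ∀ᶠ m in atTop, (f m).symm y = x) :
    ∃ a : M ≃[L] M, (∀ x, ∀ᶠ m in atTop, f m x = a x) ∧
      ∀ y, ∀ᶠ m in atTop, (f m).symm y = a.symm y := by
  obtain ⟨a, h₁, h₂⟩ := exists_limit_equiv (fun n => (f n).toEquiv) h h'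
  refine ⟨⟨a, fun {n} F xs => ?_, fun {n} R xs => ?_⟩, h₁, h₂⟩
  · obtain ⟨m, hm, hm'⟩ := ((h₁ (Structure.funMap F xs)).and
      (eventually_all.2 fun i => h₁ (xs i))).exists
    refine hm.symm.trans (((f m).map_fun F xs).trans ?_)
    congr 1
    exact funext hm'
  · obtain ⟨m, hm⟩ := (eventually_all.2 fun i => h₁ (xs i)).exists
    have hm : f m ∘ xs = a ∘ xs := funext hm
    have := (f m).map_rel R xs
    rw [hm] at this
    exact this

section

variable {L : FirstOrder.Language.{u, v}} {M : Type} [L.Structure M] (c : ℕ → M)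

/-- Agreement of two pairs, each consisting of an enumeration and an automorphism of `M`, on the
substructure generated by the first `n` terms of the sequence `c`, and of the inverses of the
enumerations below `n`. -/
def AgreeUpTo (n : ℕ) (s t : (M ≃ ℕ) × (M ≃[L] M)) : Prop :=
  (∀ x ∈ Substructure.closure L (c '' Set.Iio n),
    s.1 x = t.1 x ∧ s.2 x = t.2 x ∧ s.2.symm x = t.2.symm x) ∧
  ∀ k < n, s.1.symm k = t.1.symm k

variable {c}

open Filter in
/-- Complete sequences of pairs that agree on larger and larger parts converge. -/
theorem AgreeUpTo.complete (hc : c.Surjective) (t : ℕ → (M ≃ ℕ) × (M ≃[L] M))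
    (ht : ∀ m n, n ≤ m → AgreeUpTo c n (t m) (t n)) : ∃ a, ∀ n, AgreeUpTo c n a (t n) := by
  have hx : ∀ x, ∃ n, x ∈ Substructure.closure L (c '' Set.Iio n) := fun x => by
    obtain ⟨n, rfl⟩ := hc x
    exact ⟨n + 1, Substructure.subset_closure ⟨n, Nat.lt_succ_self n, rfl⟩⟩
  obtain ⟨π, h₁, h₂⟩ := exists_limit_equiv (fun n => (t n).1)
    (fun x => by
      obtain ⟨n, hn⟩ := hx x
      exact ⟨_, eventually_atTop.2 ⟨n, fun m hm => ((ht m n hm).1 x hn).1⟩⟩)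
    (fun k => ⟨_, eventually_atTop.2 ⟨k + 1, fun m hm => (ht m _ hm).2 k (Nat.lt_succ_self k)⟩⟩)
  obtain ⟨f, h₃, h₄⟩ := exists_limit_aut (fun n => (t n).2)
    (fun x => by
      obtain ⟨n, hn⟩ := hx x
      exact ⟨_, eventually_atTop.2 ⟨n, fun m hm => ((ht m n hm).1 x hn).2.1⟩⟩)
    (fun x => by
      obtain ⟨n, hn⟩ := hx x
      exact ⟨_, eventually_atTop.2 ⟨n, fun m hm => ((ht m n hm).1 x hn).2.2⟩⟩)
  refine ⟨(π, f), fun n => ⟨fun x hxn => ?_, fun k hk => ?_⟩⟩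
  · obtain ⟨m, e₁, e₂, e₃, hm⟩ := ((h₁ x).and ((h₃ x).and ((h₄ x).and
      (eventually_ge_atTop n)))).exists
    obtain ⟨g₁, g₂, g₃⟩ := (ht m n hm).1 x hxn
    exact ⟨e₁.symm.trans g₁, e₂.symm.trans g₂, e₃.symm.trans g₃⟩
  · obtain ⟨m, e, hm⟩ := ((h₂ k).and (eventually_ge_atTop n)).exists
    exact e.symm.trans ((ht m n hm).2 k hk)

/-- A comeager set meets the image of a map from the pairs which is compatible with open dense
sets. -/
theorem exists_mem_of_mem_residual (hc : c.Surjective) {Ω : Type*} [TopologicalSpace Ω]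
    (Φ : (M ≃ ℕ) × (M ≃[L] M) → Ω)
    (hΦ : ∀ O : Set Ω, IsOpen O → Dense O → ∀ t m, ∃ t', AgreeUpTo c m t' t ∧
      ∃ k, ∀ t'', AgreeUpTo c k t'' t' → Φ t'' ∈ O)
    {R : Set Ω} (hR : R ∈ residual Ω) (t₀ : (M ≃ ℕ) × (M ≃[L] M)) (m₀ : ℕ) :
    ∃ t, AgreeUpTo c m₀ t t₀ ∧ Φ t ∈ R := by
  obtain ⟨S, hSo, hSd, hSc, hSR⟩ := mem_residual_iff.1 hR
  obtain ⟨O, hO⟩ := (hSc.insert Set.univ).exists_eq_range (Set.insert_nonempty _ _)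
  have hOS : ∀ n, IsOpen (O n) ∧ Dense (O n) := fun n => by
    have : O n ∈ insert Set.univ S := hO ▸ Set.mem_range_self n
    rcases this with h | h
    · rw [h]
      exact ⟨isOpen_univ, dense_univ⟩
    · exact ⟨hSo _ h, hSd _ h⟩
  obtain ⟨a, ha, haO⟩ := exists_forall_mem_of_complete (AgreeUpTo c)
    (fun _ _ => ⟨fun _ _ => ⟨rfl, rfl, rfl⟩, fun _ _ => rfl⟩)
    (fun _ _ _ _ h h' => ⟨fun x hx => ⟨(h.1 x hx).1.trans (h'.1 x hx).1,
      (h.1 x hx).2.1.trans (h'.1 x hx).2.1, (h.1 x hx).2.2.trans (h'.1 x hx).2.2⟩,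
      fun k hk => (h.2 k hk).trans (h'.2 k hk)⟩)
    (fun m n _ _ hmn h => ⟨fun x hx => h.1 x (Substructure.closure_mono
      (Set.image_mono (Set.Iio_subset_Iio hmn)) hx), fun k hk => h.2 k (hk.trans_le hmn)⟩)
    (AgreeUpTo.complete hc) (fun n => Φ ⁻¹' O n)
    (fun n => hΦ (O n) (hOS n).1 (hOS n).2) t₀ m₀
  refine ⟨a, ha, hSR fun U hU => ?_⟩
  have : U ∈ Set.range O := hO ▸ Set.mem_insert_of_mem _ hU
  obtain ⟨n, rfl⟩ := this
  exact haO n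

theorem exists_subset_image_Iio (hc : c.Surjective) {s : Set M} (hs : s.Finite) :
    ∃ n, s ⊆ c '' Set.Iio n := by
  obtain ⟨b, hb⟩ := (hs.image (Function.surjInv hc)).bddAbove
  exact ⟨b + 1, fun x hx => ⟨_, Nat.lt_succ_of_le (hb ⟨x, hx, rfl⟩), Function.surjInv_eq hc x⟩⟩

theorem agreeUpTo_of_eqOn {m : ℕ} {s t : (M ≃ ℕ) × (M ≃[L] M)}
    (h₁ : ∀ x ∈ Substructure.closure L (c '' Set.Iio m), s.1 x = t.1 x)
    (h₂ : ∀ k < m, s.1 (t.1.symm k) = k) (h₃ : ∀ x ∈ c '' Set.Iio m, s.2 x = t.2 x)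
    (h₄ : ∀ x ∈ c '' Set.Iio m, s.2 (t.2.symm x) = x) : AgreeUpTo c m s t := by
  refine ⟨fun x hx => ⟨h₁ x hx, aut_eqOn_closure h₃ hx, aut_eqOn_closure (fun x hx => ?_) hx⟩,
    fun k hk => ?_⟩
  · refine s.2.injective ?_
    rw [h₄ x hx]
    exact s.2.apply_symm_apply x
  · rw [_root_.Equiv.symm_apply_eq, h₂ k hk]

/-- Comeager sets of automorphisms are dense. Only the automorphism is refined; the enumeration π
stays fixed. -/
theorem exists_aut_mem_of_mem_residual (hc : c.Surjective) (π : M ≃ ℕ) {R : Set (M ≃[L] M)}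
    (hR : R ∈ @residual _ (autTopology L M)) (f : M ≃[L] M) {s : Set M} (hs : s.Finite) :
    ∃ g ∈ R, ∀ x ∈ s, g x = f x := by
  let _ := autTopology L M
  obtain ⟨n, hn⟩ := exists_subset_image_Iio hc hs
  suffices ∃ t : (M ≃ ℕ) × (M ≃[L] M), AgreeUpTo c n t (π, f) ∧ t.2 ∈ R from
    let ⟨t, ht, htR⟩ := this
    ⟨t.2, htR, fun x hx => (ht.1 x (Substructure.subset_closure (hn hx))).2.1⟩
  refine exists_mem_of_mem_residual hc Prod.snd (fun O hO hOd t m => ?_) hR (π, f) n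
  have hfin : (c '' Set.Iio m).Finite := (Set.finite_Iio m).image c
  -- Fixing values at the preimages as well keeps the inverses in agreement.
  have hnhds : {g : M ≃[L] M | ∀ x ∈ c '' Set.Iio m ∪ t.2.symm '' (c '' Set.Iio m),
      g x = t.2 x} ∈ 𝓝 t.2 :=
    mem_nhds_autTopology_iff.2 ⟨_, hfin.union (hfin.image _), subset_rfl⟩
  obtain ⟨g, hg, hgO⟩ := mem_closure_iff_nhds.1 (hOd t.2) _ hnhds
  obtain ⟨s', hs', hsO⟩ := mem_nhds_autTopology_iff.1 (hO.mem_nhds hgO)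
  obtain ⟨k, hk⟩ := exists_subset_image_Iio hc hs'
  refine ⟨(t.1, g), agreeUpTo_of_eqOn (fun _ _ => rfl) (fun _ _ => t.1.apply_symm_apply _)
    (fun x hx => hg x (Or.inl hx)) (fun x hx => ?_), k, fun t'' ht'' => hsO fun x hx => ?_⟩
  · exact (hg _ (Or.inr ⟨x, hx, rfl⟩)).trans (t.2.apply_symm_apply x)
  · exact (ht''.1 x (Substructure.subset_closure (hk hx))).2.1

theorem AutSpace.nonempty_of_mem_residual [Countable M] (hM : L.IsUltrahomogeneous M)
    (hfg : ¬ Structure.FG L M) (hc : c.Surjective) (π : M ≃ ℕ) {R : Set (AutSpace (L.age M))}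
    (hR : R ∈ residual (AutSpace (L.age M))) : R.Nonempty := by
  suffices ∃ t : (M ≃ ℕ) × (M ≃[L] M), AgreeUpTo c 0 t (π, .refl L M) ∧
      AutSpace.ofEquiv hfg t.1 t.2 ∈ R from
    let ⟨_, _, h⟩ := this
    ⟨_, h⟩
  refine exists_mem_of_mem_residual hc (fun t => AutSpace.ofEquiv hfg t.1 t.2)
    (fun O hO hOd t m => ?_) hR _ 0
  have hfin : (c '' Set.Iio m).Finite := (Set.finite_Iio m).image c
  obtain ⟨D, hD, d, hd⟩ := exists_subsystem_of_finite (subset_refl (L.age M)) t.2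
    (hfin.union ((hfin.image t.2.symm).union ((Set.finite_Iio m).image t.1.symm)))
  obtain ⟨Y, ⟨j, hj⟩, hYO⟩ := mem_closure_iff_nhds.1 (hOd (AutSpace.ofEquiv hfg t.1 t.2)) _
    (AutSpace.mem_nhds_of_emb _ hD (fun _ h => h.1) ((AutSpace.isoOfEquiv hfg t.1 t.2).hom.comp d))
  have hj : ∀ a, AutSpace.val j a = t.1 (d.toEmb a) := hj
  obtain ⟨A, hA, i, hi⟩ := AutSpace.exists_subset_of_mem_nhds (fun _ h => h.1) Y (hO.mem_nhds hYO)
  obtain ⟨E, hE, d', e₁, e₂, he₁, he₂, -⟩ :=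
    letI := Y.str
    exists_common_subsystem (h := Y.aut) Y.age_subset hA.1.1 hD.1.1 i j Set.finite_empty
  -- The structure of Y need not be a copy of M, so its finite part E is rebuilt inside M over the
  -- old copy of D, and then M is re-enumerated as Y enumerates E.
  obtain ⟨_, k, hk⟩ := exists_emb_ofAut hM hD.1.1 hE e₂.toEmb d.toEmb
  obtain ⟨π', f', g, hg, hπ'⟩ := AutSpace.exists_extension hM hfg Y hE hE d' (Emb.refl E) k.toEmb
  have hgd : ∀ a, g.toEmb (e₂.toEmb a) = d.toEmb a := fun a => (hg _).trans (hk a)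
  have hπ'd : ∀ a, π' (d.toEmb a) = t.1 (d.toEmb a) := fun a =>
    (congrArg π' (hk a)).symm.trans ((hπ' _).trans ((he₂ a).trans (hj a)))
  have hf' : ∀ x ∈ D.map.dom, f' (d.toEmb x) = t.2 (d.toEmb x) := fun x hx => by
    refine Eq.trans ?_ (d.comm_aut ⟨x, hx⟩)
    refine (congrArg f' (hgd x)).symm.trans ?_
    exact ((g.comp e₂).comm_aut ⟨x, hx⟩).symm.trans (hgd _)
  have hcl : ∀ x ∈ Substructure.closure L (c '' Set.Iio m), ∃ a, d.toEmb a = x := fun x hx => by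
    have : Substructure.closure L (c '' Set.Iio m) ≤
        (d.toEmb : D.carrier ↪[L] M).toHom.range :=
      Substructure.closure_le.2 fun x hx => by
        obtain ⟨a, -, ha⟩ := hd x (Or.inl hx)
        exact ⟨a, ha⟩
    exact this hx
  obtain ⟨G, hGf, hG⟩ := Structure.fg_iff.1 hE.1.1
  obtain ⟨n, hn⟩ := exists_subset_image_Iio hc (hGf.image g)
  refine ⟨(π', f'), agreeUpTo_of_eqOn (fun x hx => ?_) (fun l hl => ?_) (fun x hx => ?_)
    (fun x hx => ?_), n, fun t' ht' => hi ?_⟩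
  · obtain ⟨a, rfl⟩ := hcl x hx
    exact hπ'd a
  · obtain ⟨a, -, ha⟩ := hd _ (Or.inr (Or.inr ⟨l, hl, rfl⟩))
    have := hπ'd a
    rw [ha] at this
    exact this.trans (t.1.apply_symm_apply l)
  · obtain ⟨a, ha, rfl⟩ := hd x (Or.inl hx)
    exact hf' a ha
  · obtain ⟨a, ha, hax⟩ := hd _ (Or.inr (Or.inl ⟨x, hx, rfl⟩))
    have := hf' a ha
    rw [hax] at this
    exact this.trans (t.2.apply_symm_apply x)
  -- Agreement is demanded on generated substructures because a basic neighbourhood fixes the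
  -- enumeration of all of E, which may be infinite.
  · have hg' : ∀ a, g.toEmb a ∈ Substructure.closure L (c '' Set.Iio n) := by
      have : Substructure.closure L G ≤ (Substructure.closure L (c '' Set.Iio n)).comap
          (g.toEmb : E.carrier ↪[L] M).toHom := Substructure.closure_le.2 fun a ha =>
        Substructure.subset_closure (hn ⟨a, ha, rfl⟩)
      exact fun a => this (by rw [hG]; trivial : a ∈ Substructure.closure L G)
    obtain ⟨l, hl⟩ := exists_emb_of_eqOn (g := t'.2) g hG fun a _ => (ht'.1 _ (hg' a)).2.1
    refine ⟨((AutSpace.isoOfEquiv hfg t'.1 t'.2).hom.comp l).comp e₁, fun a => ?_⟩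
    calc t'.1 (l.toEmb (e₁.toEmb a)) = t'.1 (g.toEmb (e₁.toEmb a)) := by rw [hl]
      _ = π' (g.toEmb (e₁.toEmb a)) := (ht'.1 _ (hg' _)).1
      _ = π' (k.toEmb (e₁.toEmb a)) := congrArg π' (hg _)
      _ = AutSpace.val d' (e₁.toEmb a) := hπ' _
      _ = AutSpace.val i a := he₁ a

end

/-! ### From weak limits to (JEP), (WAP) and richness -/

namespace PSystem

variable {L : FirstOrder.Language.{u, v}} {C : Set (Bundled.{w} L.Structure)}

section Total

variable {N : Type w} [L.Structure N] {h : N ≃[L] N}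

theorem jep_of_forall_nonempty_emb (hN : L.age N ⊆ C) (hC : ∀ A ∈ C, Structure.FG L A)
    (hu : ∀ A ∈ classOf C, Nonempty (Emb A (ofAut h))) : JEP (classOf C) := by
  intro A hA B hB
  obtain ⟨i⟩ := hu A hA
  obtain ⟨j⟩ := hu B hB
  obtain ⟨D, hD, -, e, k, -⟩ := exists_common_subsystem hN (hC _ hA.1) (hC _ hB.1) i j
    Set.finite_empty
  exact ⟨D, hD, ⟨e⟩, ⟨k⟩⟩

/-- Embed both extensions in (N, h), move one by an automorphism so that they agree on A, and take a
common subsystem. -/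
theorem WeaklyHomogeneous.wap (hN : L.age N ⊆ C) (hC : ∀ A ∈ C, Structure.FG L A)
    (hu : ∀ A ∈ classOf C, Nonempty (Emb A (ofAut h)))
    (hw : WeaklyHomogeneous (classOf C) (ofAut h)) : WAP (classOf C) := by
  intro A hA
  obtain ⟨B, hB, e, he⟩ := hw A hA
  refine ⟨B, hB, e, fun B₁ hB₁ B₂ hB₂ h₁ h₂ => ?_⟩
  obtain ⟨i⟩ := hu B₁ hB₁
  obtain ⟨j⟩ := hu B₂ hB₂
  obtain ⟨σ, hσ⟩ := he (i.comp h₁) (j.comp h₂)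
  obtain ⟨D, hD, d, k₁, k₂, hk₁, hk₂, -⟩ := exists_common_subsystem hN (hC _ hB₁.1) (hC _ hB₂.1)
    (σ.hom.comp i) j Set.finite_empty
  exact ⟨D, hD, k₁, k₂, fun a => d.injective ((hk₁ _).trans ((hσ a).trans (hk₂ _).symm))⟩

end Total

variable {X : PSystem.{u, v, w} L}

/-- A structure with its least partial automorphism. -/
def leastSystem (L : FirstOrder.Language.{u, v}) (P : Type w) [L.Structure P] :
    PSystem.{u, v, w} L :=
  ⟨P, ⟨⊥, ⊥, FirstOrder.Language.Equiv.refl L _⟩⟩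

/-- Every embedding into the underlying structure of a system is an embedding of the system with the
least partial map. -/
def leastSystemEmb {P : Type w} [L.Structure P] (k : P ↪[L] X.carrier) :
    Emb (leastSystem L P) X where
  toEmb := k
  map_dom x hx := (bot_le : ⊥ ≤ X.map.dom)
    (by rw [← Substructure.map_bot k.toHom]; exact ⟨x, hx, rfl⟩)
  map_cod x hx := (bot_le : ⊥ ≤ X.map.cod)
    (by rw [← Substructure.map_bot k.toHom]; exact ⟨x, hx, rfl⟩)
  comm := by
    -- Every partial isomorphism fixes the substructure generated by the empty set.
    have hid : ∀ (y : X.carrier) (hy : y ∈ (⊥ : L.Substructure X.carrier)),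
        y = X.map.toEquiv ⟨y, (bot_le : ⊥ ≤ X.map.dom) hy⟩ := by
      intro y hy
      rw [← Substructure.map_bot X.map.dom.subtype.toHom] at hy
      obtain ⟨z, hz, rfl⟩ := hy
      have : (⊥ : L.Substructure X.map.dom) ≤ X.map.dom.subtype.toHom.eqLocus
        (X.map.cod.subtype.comp X.map.toEquiv.toEmbedding).toHom := bot_le
      exact this hz
    rintro ⟨x, hx⟩
    refine hid (k x) ?_
    rw [← Substructure.map_bot k.toHom]
    exact ⟨x, hx, rfl⟩

theorem leastSystem_mem_age {P : Type w} [L.Structure P] (hP : Structure.FG L P)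
    (k : P ↪[L] X.carrier) : leastSystem L P ∈ X.age :=
  ⟨hP, Substructure.fg_bot, ⟨leastSystemEmb k⟩⟩

/-- Copies found anywhere in X by universality can be moved into position by automorphisms. For
cofinality the moved copy is the (WAP) extension of a good B around s; for extensions it is an
amalgam of B' with a good extension of B. -/
theorem WeaklyHomogeneousEverywhere.isRich {K : Set (PSystem.{u, v, w} L)}
    (hX : WeaklyHomogeneousEverywhere K X) (hage : X.age = K) (hW : WAP K) : IsRich K X where
  age_eq := hage
  cofinal s hs := by
    have hu : ∀ A ∈ K, Nonempty (Emb A X) := fun A hA => by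
      rw [← hage] at hA
      exact hA.2.2
    let P : L.Substructure X.carrier := Substructure.closure L s
    have hP : Structure.FG L P :=
      (Substructure.fg_iff_structure_fg _).1 (Substructure.fg_closure hs)
    obtain ⟨B, hB, e, j, hj, he⟩ := hX _ (hage ▸ leastSystem_mem_age hP P.subtype)
      (leastSystemEmb P.subtype)
    obtain ⟨B', hB', e', he'⟩ := hW B hB
    obtain ⟨k⟩ := hu B' hB'
    obtain ⟨σ, hσ⟩ := he (k.comp e') j
    have hsub : ∀ x ∈ s, ∃ b, σ.hom (k (e' b)) = x := fun x hx => by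
      let a : P := ⟨x, Substructure.subset_closure hx⟩
      exact ⟨e a, (hσ a).trans (hj a)⟩
    refine ⟨B', hB', σ.hom.comp k, fun x hx => ?_, ?_⟩
    · obtain ⟨b, hb⟩ := hsub x hx
      exact ⟨e' b, hb⟩
    · have : AmalgamatesOver K B' (Set.range e') := by
        intro B₁ hB₁ B₂ hB₂ h₁ h₂
        obtain ⟨D, hD, g₁, g₂, h⟩ := he' B₁ hB₁ B₂ hB₂ h₁ h₂
        exact ⟨D, hD, g₁, g₂, by rintro _ ⟨a, rfl⟩; exact h a⟩
      refine this.of_emb (Emb.refl B') fun c hc => ?_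
      obtain ⟨b, hb⟩ := hsub _ hc
      exact ⟨c, ⟨b, k.injective (σ.hom.injective hb)⟩, rfl⟩
  extension B hB B' hB' j h F _ hBF := by
    obtain ⟨B₁, hB₁, e, j₁, hj₁, he⟩ := hX B hB j
    obtain ⟨D, hD, k₁, k₂, hk⟩ := hBF B' hB' B₁ hB₁ h e
    rw [← hage] at hD
    obtain ⟨g⟩ := hD.2.2
    obtain ⟨σ, hσ⟩ := he (g.comp k₂) j₁
    refine ⟨σ.hom.comp (g.comp k₁), fun b hb => ?_⟩
    rw [Emb.comp_apply, Emb.comp_apply, hk b hb]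
    exact (hσ b).trans (hj₁ b)

theorem exists_eq_ofAut (hd : X.map.dom = ⊤) (hc : X.map.cod = ⊤) :
    ∃ h : X.carrier ≃[L] X.carrier, X = ofAut h := by
  rcases X with @⟨N, _, dom, cod, e⟩
  change dom = ⊤ at hd
  change cod = ⊤ at hc
  subst hd hc
  exact ⟨Substructure.topEquiv.comp (e.comp Substructure.topEquiv.symm), rfl⟩

/-- The partial map of a rich system is an automorphism. -/
theorem IsRich.exists_eq_ofAut {M : Type w} [L.Structure M] (hM : L.IsUltrahomogeneous M)
    (hX : IsRich (classOf (L.age M)) X) : ∃ h : X.carrier ≃[L] X.carrier, X = ofAut h := by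
  have key : ∀ a : X.carrier, a ∈ X.map.dom ∧ a ∈ X.map.cod := by
    intro a
    obtain ⟨B, hB, j, ha, hj⟩ := hX.cofinal {a} (Set.finite_singleton a)
    obtain ⟨b, rfl⟩ := ha rfl
    obtain ⟨f, ⟨k⟩⟩ := exists_emb_ofAut_of_mem hM hB
    -- In (M, f) the point has an image and a preimage. D has both the point and its preimage in its
    -- domain, and richness realizes D in X with the point at a.
    obtain ⟨D, hD, d, e, -, he, -, hd⟩ := exists_common_subsystem (subset_refl (L.age M)) hB.1.1
      hB.1.1 k k (s := {k.toEmb b, f.symm (k.toEmb b)}) ((Set.finite_singleton _).insert _)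
    obtain ⟨g, hg⟩ := hX.extension B hB D hD j e _
      ((Set.finite_singleton _).preimage j.injective.injOn) hj
    rw [← hg b rfl]
    constructor
    · obtain ⟨c, hc, hcb⟩ := hd _ (Or.inl rfl)
      rw [← he b] at hcb
      rw [← d.injective hcb]
      exact g.map_dom c hc
    · obtain ⟨c, hc, hcb⟩ := hd _ (Or.inr rfl)
      obtain ⟨y, hy, hyc⟩ := d.apply_mem_cod hc
      have : y = e b := d.injective <|
        (hyc.trans ((congrArg f hcb).trans (f.apply_symm_apply _))).trans (he b).symm
      rw [← this]
      exact g.map_cod y hy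
  exact PSystem.exists_eq_ofAut (eq_top_iff.2 fun a _ => (key a).1)
    (eq_top_iff.2 fun a _ => (key a).2)

/-- Conjugation as an isomorphism of systems. -/
def Iso.conj {M : Type w} [L.Structure M] (f g : M ≃[L] M) :
    Iso (ofAut f) (ofAut (g.comp (f.comp g.symm))) :=
  Iso.ofEquiv g fun x => by
    change g (f x) = g (f (g.symm (g x)))
    rw [g.symm_apply_apply]

end PSystem

/-! ### Generic automorphisms -/

section Generic

variable {L : FirstOrder.Language.{u, v}} {M : Type} [L.Structure M] {c : ℕ → M} {f : M ≃[L] M}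

/-- A embeds in some (M, f₀), and the conjugacy class of f is dense, so a conjugate of f agrees with
f₀ on the image of generators. -/
theorem IsGenericAut.nonempty_emb (hf : IsGenericAut f) (hM : L.IsUltrahomogeneous M)
    (hc : c.Surjective) (π : M ≃ ℕ) {A : PSystem.{u, v, 0} L} (hA : A ∈ classOf (L.age M)) :
    Nonempty (Emb A (ofAut f)) := by
  obtain ⟨f₀, ⟨i⟩⟩ := exists_emb_ofAut_of_mem hM hA
  obtain ⟨G, hGf, hG⟩ := Structure.fg_iff.1 hA.1.1
  obtain ⟨_, ⟨v, rfl⟩, hg⟩ := exists_aut_mem_of_mem_residual hc π hf f₀ (hGf.image i)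
  obtain ⟨j, -⟩ := exists_emb_of_eqOn i hG fun a ha => hg _ ⟨a, ha, rfl⟩
  exact ⟨(Iso.conj f v).inv.comp j⟩

/-- If `f` is generic, then its orbit under the automorphisms with prescribed values on a finite set
is somewhere dense, for some choice of the values. -/
theorem IsGenericAut.exists_nonempty_interior [Countable M] (hf : IsGenericAut f)
    (hc : c.Surjective) (π : M ≃ ℕ) {s : Set M} (hs : s.Finite) :
    letI := autTopology L M
    ∃ q : s → M, (interior (_root_.closure
      {g : M ≃[L] M | ∃ v : M ≃[L] M, (∀ x : s, v x = q x) ∧ g = v.comp (f.comp v.symm)})).Nonempty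
      := by
  let _ := autTopology L M
  have := hs.to_subtype
  by_contra! hcon
  have hres : ∀ᶠ g in residual (M ≃[L] M), ∀ q : s → M, g ∈ (_root_.closure
      {g : M ≃[L] M | ∃ v : M ≃[L] M, (∀ x : s, v x = q x) ∧ g = v.comp (f.comp v.symm)})ᶜ :=
    eventually_countable_forall.2 fun q => residual_of_dense_open isClosed_closure.isOpen_compl
      (interior_eq_empty_iff_dense_compl.1 (hcon q))
  obtain ⟨_, ⟨⟨v, rfl⟩, hv⟩, -⟩ := exists_aut_mem_of_mem_residual hc π (Filter.inter_mem hf hres) f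
    Set.finite_empty
  exact hv (fun x => v x) (subset_closure ⟨v, fun _ => rfl, rfl⟩)

theorem IsGenericAut.wap [Countable M] (hf : IsGenericAut f) (hM : L.IsUltrahomogeneous M)
    (hc : c.Surjective) (π : M ≃ ℕ) : WAP (classOf (L.age M)) := by
  let _ := autTopology L M
  intro A hA
  obtain ⟨i⟩ := hf.nonempty_emb hM hc π hA
  obtain ⟨G, hGf, hG⟩ := Structure.fg_iff.1 hA.1.1
  obtain ⟨q, f₀, hf₀⟩ := hf.exists_nonempty_interior hc π (hGf.image i.toEmb)
  obtain ⟨f₁, hf₁, v₀, hv₀, rfl⟩ := mem_closure_iff_nhds.1 (interior_subset hf₀) _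
    (isOpen_interior.mem_nhds hf₀)
  obtain ⟨B₀, hB₀, j₀, hj₀⟩ := (autIndexed hM).exists_subset _ _ (isOpen_interior.mem_nhds hf₁)
  obtain ⟨B, hB, j, e, k, he, hk, -⟩ := exists_common_subsystem (subset_refl (L.age M)) hA.1.1
    hB₀.1.1 ((Iso.conj f v₀).hom.comp i) j₀ Set.finite_empty
  -- B' is realized at some f' near f₁, hence also at a conjugate of f by some v in the same piece.
  -- As v and v₀ agree on i(A), conjugating back returns A to i.
  have key : ∀ B' ∈ classOf (L.age M), ∀ h : Emb B B', ∃ l : Emb B' (ofAut f),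
      ∀ a, l (h (e a)) = i a := by
    intro B' hB' h
    obtain ⟨f', g, hg⟩ := (autIndexed hM).exists_extension _ B hB B' hB' j h
    have hf' := interior_subset (hj₀ (a := f') ⟨(g.comp h).comp k, fun a => (hg _).trans (hk a)⟩)
    obtain ⟨_, ⟨g', hg'⟩, v, hv, rfl⟩ := mem_closure_iff_nhds.1 hf' _
      ((autIndexed hM).mem_nhds f' B' hB' g)
    refine ⟨(Iso.conj f v).inv.comp g', fun a => ?_⟩
    have h₁ : ∀ a, v (i.toEmb a) = v₀ (i.toEmb a) := embedding_eq_of_eqOn hG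
      (i := v.toEmbedding.comp (i.toEmb : A.carrier ↪[L] M))
      (j := v₀.toEmbedding.comp (i.toEmb : A.carrier ↪[L] M)) fun a ha =>
        (hv ⟨_, a, ha, rfl⟩).trans (hv₀ ⟨_, a, ha, rfl⟩).symm
    have h₂ : g' (h (e a)) = (Iso.conj f v).hom (i a) :=
      (hg' _).trans ((hg _).trans ((he a).trans (h₁ a).symm))
    exact (congrArg (fun x => (Iso.conj f v).inv x) h₂).trans ((Iso.conj f v).left_inv _)
  refine ⟨B, hB, e, fun B₁ hB₁ B₂ hB₂ h₁ h₂ => ?_⟩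
  obtain ⟨l₁, hl₁⟩ := key B₁ hB₁ h₁
  obtain ⟨l₂, hl₂⟩ := key B₂ hB₂ h₂
  obtain ⟨D, hD, d, k₁, k₂, hk₁, hk₂, -⟩ := exists_common_subsystem (subset_refl (L.age M))
    hB₁.1.1 hB₂.1.1 l₁ l₂ Set.finite_empty
  exact ⟨D, hD, k₁, k₂, fun a => d.injective <|
    (hk₁ _).trans ((hl₁ a).trans ((hk₂ _).trans (hl₂ a)).symm)⟩

theorem isRich_mem_residual_aut [Countable M] (hM : L.IsUltrahomogeneous M)
    (hJ : JEP (classOf (L.age M)))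
    (hW : WAP (classOf (L.age M))) :
    {f : M ≃[L] M | IsRich (classOf (L.age M)) (ofAut f)} ∈ @residual _ (autTopology L M) := by
  let _ := autTopology L M
  obtain ⟨ι, _, D, _, hD, hcof⟩ := exists_countable_cofinal hM
  exact (autIndexed hM).isRich_mem_residual (fun _ h => h.1) hJ hW D hD hcof

theorem isRich_mem_residual_autSpace [Countable M] (hM : L.IsUltrahomogeneous M)
    (hfg : ¬ Structure.FG L M)
    (hJ : JEP (classOf (L.age M))) (hW : WAP (classOf (L.age M))) :
    {Y : AutSpace (L.age M) | IsRich (classOf (L.age M)) Y.toPSystem} ∈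
      residual (AutSpace (L.age M)) := by
  obtain ⟨ι, _, D, _, hD, hcof⟩ := exists_countable_cofinal hM
  exact (AutSpace.indexed hM hfg).isRich_mem_residual (fun _ h => h.1) hJ hW D hD hcof

theorem PSystem.IsRich.isGenericAut [Countable M] (hf : IsRich (classOf (L.age M)) (ofAut f))
    (hM : L.IsUltrahomogeneous M) (hJ : JEP (classOf (L.age M))) (hW : WAP (classOf (L.age M))) :
    IsGenericAut f := by
  refine Filter.mem_of_superset (isRich_mem_residual_aut hM hJ hW) fun g hg => ?_
  obtain ⟨e, he⟩ := hf.nonempty_iso subset_rfl subset_rfl (fun _ h => h.1) hg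
  refine ⟨e, FirstOrder.Language.Equiv.ext fun x => ?_⟩
  change g x = e (f (e.symm x))
  rw [he, e.apply_symm_apply]

theorem PSystem.IsRich.nonempty_iso_autSpace {N : Type} [L.Structure N] [Countable N]
    {h : N ≃[L] N} (hN : L.age N ⊆ L.age M) (hh : IsRich (classOf (L.age M)) (ofAut h))
    {Y : AutSpace (L.age M)} (hY : IsRich (classOf (L.age M)) Y.toPSystem) :
    Nonempty (Iso (ofAut h) Y.toPSystem) := by
  let _ := Y.str
  obtain ⟨e, he⟩ := hh.nonempty_iso (g := Y.aut) hN Y.age_subset (fun _ h => h.1) hY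
  exact ⟨Iso.ofEquiv e he⟩

theorem PSystem.IsRich.isoType_mem_residual [Countable M]
    (hf : IsRich (classOf (L.age M)) (ofAut f))
    (hM : L.IsUltrahomogeneous M) (hfg : ¬ Structure.FG L M) (hJ : JEP (classOf (L.age M)))
    (hW : WAP (classOf (L.age M))) :
    AutSpace.isoType (L.age M) (ofAut f) ∈ residual (AutSpace (L.age M)) :=
  Filter.mem_of_superset (isRich_mem_residual_autSpace hM hfg hJ hW)
    fun _ hY => hf.nonempty_iso_autSpace subset_rfl hY

end Generic

/-! ### The theorem -/

theorem theorem2p6 {L : FirstOrder.Language.{u, v}}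
    [Countable (Σ n, L.Functions n)] [Countable (Σ n, L.Relations n)]
    (C : Set (Bundled.{0} L.Structure)) (hC : IsFraisse C)
    (M : Type) [L.Structure M] [Countable M] (hM : IsFraisseLimit C M)
    (hfg : ¬ Structure.FG L M) :
    List.TFAE
      [ PSystem.JEP (PSystem.classOf C) ∧ PSystem.WAP (PSystem.classOf C),
        ∃ X : AutSpace C, PSystem.IsWeakFraisseLimit (PSystem.classOf C) X.toPSystem ∧
          AutSpace.isoType C X.toPSystem ∈ residual (AutSpace C),
        ∃ f : M ≃[L] M, IsGenericAut f ] ∧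
    (PSystem.JEP (PSystem.classOf C) ∧ PSystem.WAP (PSystem.classOf C) →
      (∀ f : M ≃[L] M, IsGenericAut f →
        PSystem.IsWeakFraisseLimit (PSystem.classOf C) (PSystem.ofAut f) ∧
        PSystem.WeaklyHomogeneousEverywhere (PSystem.classOf C) (PSystem.ofAut f) ∧
        AutSpace.isoType C (PSystem.ofAut f) ∈ residual (AutSpace C)) ∧
      (∀ X : PSystem.{u, v, 0} L, PSystem.IsWeakFraisseLimit (PSystem.classOf C) X →
        AutSpace.isoType C X ∈ residual (AutSpace C) ∨
          PSystem.WeaklyHomogeneousEverywhere (PSystem.classOf C) X →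
        ∃ f : M ≃[L] M, IsGenericAut f ∧ Nonempty (PSystem.Iso X (PSystem.ofAut f)))) := by
  obtain rfl := hM.age
  have hu := hM.ultrahomogeneous
  have hFG : ∀ A ∈ L.age M, Structure.FG L A := fun _ h => h.1
  have : Infinite M := not_finite_iff_infinite.1 fun _ => hfg Structure.FG.of_finite
  obtain ⟨π⟩ := nonempty_equiv_of_countable (α := M) (β := ℕ)
  have hc := π.symm.surjective
  have exists_rich : JEP (classOf (L.age M)) → WAP (classOf (L.age M)) →
      ∃ f : M ≃[L] M, IsRich (classOf (L.age M)) (ofAut f) := fun hJ hW => by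
    obtain ⟨f, hf, -⟩ := exists_aut_mem_of_mem_residual hc π (isRich_mem_residual_aut hu hJ hW)
      (.refl L M) Set.finite_empty
    exact ⟨f, hf⟩
  refine ⟨?_, ?_⟩
  · tfae_have 1 → 2 := fun ⟨hJ, hW⟩ => by
      have hres := isRich_mem_residual_autSpace hu hfg hJ hW
      obtain ⟨X, hX⟩ := AutSpace.nonempty_of_mem_residual hu hfg hc π hres
      let _ := X.str
      exact ⟨X, IsRich.isWeakFraisseLimit (f := X.aut) X.age_subset hFG hX,
        Filter.mem_of_superset hres fun Y hY =>
          IsRich.nonempty_iso_autSpace (h := X.aut) X.age_subset hX hY⟩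
    tfae_have 2 → 1 := fun ⟨X, hX, _⟩ => by
      let _ := X.str
      have hu : ∀ A ∈ classOf (L.age M), Nonempty (Emb A (ofAut X.aut)) := fun A hA => by
        rw [← hX.universal] at hA
        exact hA.2.2
      exact ⟨jep_of_forall_nonempty_emb X.age_subset hFG hu,
        WeaklyHomogeneous.wap X.age_subset hFG hu hX.weaklyHomogeneous⟩
    tfae_have 1 → 3 := fun ⟨hJ, hW⟩ => by
      obtain ⟨f, hf⟩ := exists_rich hJ hW
      exact ⟨f, hf.isGenericAut hu hJ hW⟩
    tfae_have 3 → 1 := fun ⟨f, hf⟩ =>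
      ⟨jep_of_forall_nonempty_emb subset_rfl hFG fun _ hA => hf.nonempty_emb hu hc π hA,
        hf.wap hu hc π⟩
    tfae_finish
  · rintro ⟨hJ, hW⟩
    refine ⟨fun f hf => ?_, fun X hX h => ?_⟩
    · obtain ⟨_, ⟨⟨v, rfl⟩, hv⟩, -⟩ := exists_aut_mem_of_mem_residual hc π
        (Filter.inter_mem hf (isRich_mem_residual_aut hu hJ hW)) (.refl L M) Set.finite_empty
      have hf : IsRich (classOf (L.age M)) (ofAut f) :=
        IsRich.of_iso hv ⟨(Iso.conj f v).inv, (Iso.conj f v).hom, (Iso.conj f v).right_inv,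
          (Iso.conj f v).left_inv⟩
      exact ⟨hf.isWeakFraisseLimit subset_rfl hFG,
        hf.weaklyHomogeneousEverywhere subset_rfl hFG,
        hf.isoType_mem_residual hu hfg hJ hW⟩
    · obtain ⟨f, hf⟩ := exists_rich hJ hW
      refine ⟨f, hf.isGenericAut hu hJ hW, ?_⟩
      rcases h with h | h
      · obtain ⟨Y, ⟨σ⟩, hY⟩ := AutSpace.nonempty_of_mem_residual hu hfg hc π
          (Filter.inter_mem h (isRich_mem_residual_autSpace hu hfg hJ hW))
        obtain ⟨τ⟩ := hf.nonempty_iso_autSpace subset_rfl hY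
        exact ⟨⟨τ.inv.comp σ.hom, σ.inv.comp τ.hom,
          fun x => by rw [Emb.comp_apply, Emb.comp_apply, τ.right_inv, σ.left_inv],
          fun x => by rw [Emb.comp_apply, Emb.comp_apply, σ.right_inv, τ.left_inv]⟩⟩
      · have hrich := h.isRich hX.universal hW
        have := hX.countable
        obtain ⟨g, hg⟩ := hrich.exists_eq_ofAut hu
        -- Universality speaks of systems; giving each finitely generated substructure its least
        -- partial map recovers the age of the structure.
        have hage : L.age X.carrier ⊆ L.age M := fun A hA => by
          obtain ⟨k⟩ := hA.2
          have := leastSystem_mem_age hA.1 k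
          rw [hX.universal] at this
          exact this.1
        rw [hg] at hrich ⊢
        obtain ⟨e, he⟩ := hrich.nonempty_iso hage subset_rfl hFG hf
        exact ⟨Iso.ofEquiv e he⟩
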